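/- **Theorem 3.3 (From DM to CTMC Lyapunov).** *Setting.* For $n=1,2,\dots$ let $X^n$ be a continuous time Markov chain on a nonempty countable set $E^n\subset\mathbb R^d$ with jump rates $q^n(x,y)$, $x\ne y$, $\sum_y q^n(x,y)<\infty$; each $X^n$ is nonexplosive and irreducible. (Positive recurrence is *not* assumed.) Let $F^n:\mathbb R^d\to\mathbb R^d$ and $a^n:\mathbb R^d\to\mathbb R^{d\times d}$ be functions with $$F^n(x)=\sum_{y}(y-x)\,q^n(x,y),\qquad a^n(x)=\sum_{y}(y-x)(y-x)^{\top}q^n(x,y)\qquad(x\in E^n),$$ and let $\bar x^n_\infty\in\mathbb R^d$ be the unique zero of $F^n$. Put $$\widehat X^n=\frac{X^n-\bar x^n_\infty}{\sqrt n},\quad \widehat F^n(x)=\frac{F^n(\bar x^n_\infty+\sqrt n\,x)}{\sqrt n},\quad \bar a^n(x)=\frac{a^n(\bar x^n_\infty+\sqrt n\,x)}{n},$$ and let $\widehat E^n$ be the state space of $\widehat X^n$. Assume * $\bar\ell:=\sup\{|y-x| : n\ge 1,\ q^n(x,y)>0\}<\infty$; * there are constants $K_F,K_a$ with $|\widehat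 F^n(x)-\widehat F^n(y)|\le K_F|x-y|$ and $|\bar a^n(x)-\bar a^n(0)|\le \frac{K_a}{\sqrt n}|x|$ for all $n$ and $x,y\in\mathbb R^d$; * $\bar a^n(0)$ is positive definite for each $n$ and $\bar a^n(0)\to\bar a$ with $\bar a$ positive definite. Let $\mathcal A^n f(x)=\sum_i\widehat F^n_i(x)\,\partial_i f(x)+\frac12\sum_{i,j}\bar a^n_{ij}(0)\,\partial_{ij}f(x)$. Write $\mathbb E_x$ for expectation given $\widehat X^n(0)=x$, $B_x(r)$ for the open ball of radius $r$ around $x$, and $$[V]_{2,1,B}=\sup_{y,z\in B,\,y\ne z}\frac{|D^2V(y)-D^2V(z)|}{|y-z|}\in[0,\infty].$$ *Hypotheses on $V$.* Let $V\in C^2(\mathbb R^d)$ and $b,\delta,K\in(0,\infty)$ be such that * $V\ge 1$; $V(x)\to\infty$ as $|x|\to\infty$; and for some constants $c_1,c_2,c_3$ and all $x$: $|DV(x)|\vee|D^2V(x)|\le c_1e^{c_2|x|}$ and $\sup_{|y|\le 1}V(x+y)/V(x)\le c_3$; * $\mathcal A^nV(x)\le-\delta V(x)+b\,\mathbf 1_{\{|x|\le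 K\}}$ for all $n$ and all $x\in\mathbb R^d$; * $\mathbb E_x\Big[\int_0^t\big((1+|\widehat X^n(s)|)^4V(\widehat X^n(s))\big)^2ds\Big]<\infty$ for all $n$, $x\in\widehat E^n$, $t\ge0$; * there is a constant $C\in(0,\infty)$ such that for all $n$ and all $x\in\mathbb R^d$ $$\big(|DV(x)|+|D^2V(x)|+[V]_{2,1,B_x(\bar\ell/\sqrt n)}\big)(1+|x|)\le C\,V(x).$$ *Conclusion.* 1. There is $N$ such that for all $n\ge N$, all $x\in\widehat E^n$ and all $t\ge 0$, $V(\widehat X^n(t))$ is integrable under $\mathbb P_x$, $\mathbb E_x\int_0^tV(\widehat X^n(s))\,ds<\infty$, and $$\mathbb E_x\big[V(\widehat X^n(t))\big]\le V(x)+\mathbb E_x\Big[\int_0^t\Big(-\frac\delta2V(\widehat X^n(s))+b\Big)ds\Big].$$ 2. For every $n\ge N$ such that either $E^n$ has only finitely many points in each bounded set, or $\widehat X^n$ has a stationary distribution (e.g. because it is positive recurrent), $\widehat X^n$ is ergodic: it has a stationary distribution, to which the law of $\widehat X^n(t)$ converges in total variation as $t\to\infty$ from every initial state $x\in\widehat E^n$.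 3. If $\nu^n$ is the steady-state distribution of $\widehat X^n$ for all large $n$ (i.e. a probability measure on $\widehat E^n$ with $\mathbb E_x f(\widehat X^n(t))\to\nu^n(f)$ as $t\to\infty$ for all bounded continuous $f$ and all $x\in\widehat E^n$), then $$\limsup_{n\to\infty}\nu^n(V)\le\frac{2b}{\delta}.$$ -/

import Mathlib

open Filter Topology MeasureTheory
open scoped NNReal ENNReal BoundedContinuousFunction

noncomputable section

/-! ### Continuous time Markov chains on a countable set -/

section CTMC

variable {S : Type*}

/-- Total jump rate out of `x`. -/
def exitRate (q : S → S → ℝ≥0) (x : S) : ℝ := ∑' z, (q x z : ℝ)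

open Classical in
/-- `transAux q k t x y` is the probability that the chain with jump rates `q`, started at `x`,
makes at most `k` jumps before time `t ≥ 0` and is at `y` at time `t`
(decomposition at the first jump). -/
def transAux (q : S → S → ℝ≥0) : ℕ → ℝ → S → S → ℝ≥0∞
  | 0, t, x, y => if x = y then ENNReal.ofReal (Real.exp (-(exitRate q x * t))) else 0
  | k + 1, t, x, y =>
      (if x = y then ENNReal.ofReal (Real.exp (-(exitRate q x * t))) else 0) +
        ∫⁻ s in Set.Icc (0 : ℝ) t, ENNReal.ofReal (Real.exp (-(exitRate q x * s))) *
          ∑' z, (q x z : ℝ≥0∞) * transAux q k (t - s) z y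

/-- The transition function of the chain with jump rates `q`: the minimal nonnegative solution of
Kolmogorov's backward equation, obtained by Feller's iteration. -/
def transProb (q : S → S → ℝ≥0) (t : ℝ) (x y : S) : ℝ≥0∞ := ⨆ k, transAux q k t x y

/-- Infinitely many jumps in finite time have probability zero. -/
def Nonexplosive (q : S → S → ℝ≥0) : Prop :=
  ∀ t : ℝ, 0 ≤ t → ∀ x, ∑' y, transProb q t x y = 1

/-- Every state can be reached from every other one through jumps of positive rate. -/
def IrreducibleRates (q : S → S → ℝ≥0) : Prop :=
  ∀ x y, Relation.ReflTransGen (fun u v => 0 < q u v) x y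

variable {Ω : Type*} [MeasurableSpace Ω] [MeasurableSpace S]

/-- Under the laws `P x`, `x ∈ S`, the process `(X t)`, `t ≥ 0`, is the continuous time Markov
chain with jump rates `q` started at `x`: it is right-continuous for the discrete topology, and its
finite-dimensional distributions are given by the transition function of `q`.
(Values of `X` at negative times are irrelevant.) -/
structure IsCTMC (q : S → S → ℝ≥0) (P : S → Measure Ω) (X : ℝ → Ω → S) : Prop where
  prob : ∀ x, IsProbabilityMeasure (P x)
  measurable : ∀ t, 0 ≤ t → Measurable (X t)
  rightCont : ∀ ω t, 0 ≤ t → ∀ᶠ s in 𝓝[>] t, X s ω = X t ω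
  start : ∀ x, ∀ᵐ ω ∂P x, X 0 ω = x
  fdd : ∀ (x : S) (k : ℕ) (τ : Fin (k + 1) → ℝ) (y : Fin (k + 1) → S), 0 ≤ τ 0 → Monotone τ →
    P x {ω | ∀ i, X (τ i) ω = y i} = transProb q (τ 0) x (y 0) *
      ∏ i : Fin k, transProb q (τ i.succ - τ i.castSucc) (y i.castSucc) (y i.succ)

/-- `ν` is a stationary distribution of the Markov process `ξ` with laws `P x`:
`E_ν f(ξ(t)) = E_ν f(ξ(0))` for bounded continuous `f` and `t ≥ 0`. -/
def IsStationaryDist [TopologicalSpace S] (P : S → Measure Ω) (ξ : ℝ → Ω → S) (ν : Measure S) :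
    Prop :=
  IsProbabilityMeasure ν ∧ ∀ (f : S →ᵇ ℝ) (t : ℝ), 0 ≤ t →
    ∫ x, (∫ ω, f (ξ t ω) ∂P x) ∂ν = ∫ x, (∫ ω, f (ξ 0 ω) ∂P x) ∂ν

/-- `ν` is the steady-state distribution of `ξ`: `E_x f(ξ(t)) → ν(f)` as `t → ∞` for all bounded
continuous `f` and all initial states `x`. -/
def IsSteadyStateDist [TopologicalSpace S] (P : S → Measure Ω) (ξ : ℝ → Ω → S) (ν : Measure S) :
    Prop :=
  IsProbabilityMeasure ν ∧ ∀ (f : S →ᵇ ℝ) (x : S),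
    Tendsto (fun t : ℝ => ∫ ω, f (ξ t ω) ∂P x) atTop (𝓝 (∫ y, f y ∂ν))

/-- Ergodicity on a countable state space: there is a stationary distribution, to which the law
of `ξ(t)` converges in total variation (tested against all bounded functions) from every initial
state. -/
def IsErgodic [TopologicalSpace S] (P : S → Measure Ω) (ξ : ℝ → Ω → S) : Prop :=
  ∃ ν : Measure S, IsStationaryDist P ξ ν ∧
    ∀ f : S → ℝ, (∃ B : ℝ, ∀ y, |f y| ≤ B) → ∀ x,
      Tendsto (fun t : ℝ => ∫ ω, f (ξ t ω) ∂P x) atTop (𝓝 (∫ y, f y ∂ν))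

end CTMC

/-! ### The sequence of chains -/

/-- Euclidean (Frobenius) norm of a matrix. -/
def matNorm {d : ℕ} (A : Matrix (Fin d) (Fin d) ℝ) : ℝ := √(∑ i, ∑ j, A i j ^ 2)

/-- The data of the sequence, `n = 1, 2, …`: state spaces, jump rates, drift and quadratic
variation density (extended to all of `ℝ^d`), and fluid stationary points. -/
structure ChainSeq (d : ℕ) where
  E : ℕ+ → Set (EuclideanSpace ℝ (Fin d))
  q : ∀ n, E n → E n → ℝ≥0
  F : ℕ+ → EuclideanSpace ℝ (Fin d) → EuclideanSpace ℝ (Fin d)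
  a : ℕ+ → EuclideanSpace ℝ (Fin d) → Matrix (Fin d) (Fin d) ℝ
  xbar : ℕ+ → EuclideanSpace ℝ (Fin d)

namespace ChainSeq

variable {d : ℕ} (M : ChainSeq d)

/-- `F̂ⁿ(x) = Fⁿ(x̄ⁿ + √n x) / √n`. -/
def Fhat (n : ℕ+) (x : EuclideanSpace ℝ (Fin d)) : EuclideanSpace ℝ (Fin d) :=
  (√(n : ℝ))⁻¹ • M.F n (M.xbar n + √(n : ℝ) • x)

/-- `āⁿ(x) = aⁿ(x̄ⁿ + √n x) / n`. -/
def abar (n : ℕ+) (x : EuclideanSpace ℝ (Fin d)) : Matrix (Fin d) (Fin d) ℝ :=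
  (n : ℝ)⁻¹ • M.a n (M.xbar n + √(n : ℝ) • x)

/-- Sizes of the jumps that occur with positive rate in some chain of the sequence. -/
def jumpSizes : Set ℝ :=
  {r | ∃ (n : ℕ+) (x y : M.E n), 0 < M.q n x y ∧ r = ‖(y : EuclideanSpace ℝ (Fin d)) - x‖}

/-- The maximal jump size. -/
def lbar : ℝ := sSup M.jumpSizes

/-- The state space of the scaled chain. -/
def Ehat (n : ℕ+) : Set (EuclideanSpace ℝ (Fin d)) :=
  (fun x => (√(n : ℝ))⁻¹ • (x - M.xbar n)) '' M.E n

/-- `x ↦ (x - x̄ⁿ) / √n`, so that the scaled chain is `X̂ⁿ(t) = toHat n (Xⁿ(t))`. -/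
def toHat (n : ℕ+) (x : M.E n) : M.Ehat n :=
  ⟨(√(n : ℝ))⁻¹ • ((x : EuclideanSpace ℝ (Fin d)) - M.xbar n), x, x.2, rfl⟩

/-- The inverse of `toHat`. -/
def ofHat (n : ℕ+) (x : M.Ehat n) : M.E n :=
  ⟨M.xbar n + √(n : ℝ) • (x : EuclideanSpace ℝ (Fin d)), by
    obtain ⟨x, z, hz, rfl⟩ := x
    have h : √(n : ℝ) ≠ 0 := (Real.sqrt_pos.2 (by exact_mod_cast n.pos)).ne'
    simpa [smul_smul, h] using hz⟩

/-- The standing assumptions on the chains (positive recurrence is not part of them). -/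
structure Base : Prop where
  countable : ∀ n, (M.E n).Countable
  nonempty : ∀ n, (M.E n).Nonempty
  rate_self : ∀ n x, M.q n x x = 0
  rate_summable : ∀ n x, Summable (M.q n x)
  nonexplosive : ∀ n, Nonexplosive (M.q n)
  irreducible : ∀ n, IrreducibleRates (M.q n)
  F_eq : ∀ n (x : M.E n) i, M.F n x i = ∑' y : M.E n, (M.q n x y : ℝ) * (y.1 i - x.1 i)
  a_eq : ∀ n (x : M.E n) i j, M.a n x i j =
    ∑' y : M.E n, (M.q n x y : ℝ) * ((y.1 i - x.1 i) * (y.1 j - x.1 j))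
  F_zero : ∀ n x, M.F n x = 0 ↔ x = M.xbar n
  jumps_bdd : BddAbove M.jumpSizes
  F_lipschitz : ∃ KF : ℝ, ∀ n x y, ‖M.Fhat n x - M.Fhat n y‖ ≤ KF * ‖x - y‖
  a_growth : ∃ Ka : ℝ, ∀ n x, matNorm (M.abar n x - M.abar n 0) ≤ Ka / √(n : ℝ) * ‖x‖
  a_posDef : ∀ n, (M.abar n 0).PosDef
  a_tendsto : ∃ A : Matrix (Fin d) (Fin d) ℝ, A.PosDef ∧
    Tendsto (fun n => M.abar n 0) atTop (𝓝 A)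

/-- The generator `𝒜ⁿ` of the diffusion model
`dY = F̂ⁿ(Y) dt + √(āⁿ(0)) dB`. -/
def generator (n : ℕ+) (f : EuclideanSpace ℝ (Fin d) → ℝ) (x : EuclideanSpace ℝ (Fin d)) : ℝ :=
  ∑ i, M.Fhat n x i * fderiv ℝ f x (EuclideanSpace.single i 1) +
    1 / 2 * ∑ i, ∑ j, M.abar n 0 i j *
      fderiv ℝ (fderiv ℝ f) x (EuclideanSpace.single i 1) (EuclideanSpace.single j 1)

end ChainSeq

/-! ### Lyapunov functions -/

/-- Sub-exponential functions. -/
structure SubExponential {d : ℕ} (V : EuclideanSpace ℝ (Fin d) → ℝ) : Prop where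
  contDiff : ContDiff ℝ 2 V
  one_le : ∀ x, 1 ≤ V x
  exp_bound : ∃ c₁ c₂ : ℝ, ∀ x,
    max ‖fderiv ℝ V x‖ ‖fderiv ℝ (fderiv ℝ V) x‖ ≤ c₁ * Real.exp (c₂ * ‖x‖)
  local_bound : ∃ c₃ : ℝ, ∀ x y, ‖y‖ ≤ 1 → V (x + y) / V x ≤ c₃

/-- `V(x) → ∞` as `|x| → ∞`. -/
def NormLike {d : ℕ} (V : EuclideanSpace ℝ (Fin d) → ℝ) : Prop :=
  Tendsto V (comap (fun x => ‖x‖) atTop) atTop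

/-- `[Ψ]_{2,1,B}`, the (possibly infinite) Lipschitz constant of `D²Ψ` on `B`;
note that `0 / 0 = 0` in `ℝ≥0∞`. -/
def lipHess {d : ℕ} (Ψ : EuclideanSpace ℝ (Fin d) → ℝ) (B : Set (EuclideanSpace ℝ (Fin d))) :
    ℝ≥0∞ :=
  ⨆ y ∈ B, ⨆ z ∈ B, edist (fderiv ℝ (fderiv ℝ Ψ) y) (fderiv ℝ (fderiv ℝ Ψ) z) / edist y z

/-- The uniform Lyapunov assumption for `V` with constants `b, δ, K`, where the chains `Xⁿ` live on
`Ω n` and have laws `P n x`. -/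
structure UniformLyapunov {d : ℕ} (M : ChainSeq d) {Ω : ℕ+ → Type*} [∀ n, MeasurableSpace (Ω n)]
    (P : ∀ n, M.E n → Measure (Ω n)) (X : ∀ n, ℝ → Ω n → M.E n)
    (V : EuclideanSpace ℝ (Fin d) → ℝ) (b δ K : ℝ) : Prop where
  subExp : SubExponential V
  normLike : NormLike V
  b_pos : 0 < b
  δ_pos : 0 < δ
  K_pos : 0 < K
  drift : ∀ n x, M.generator n V x ≤
    -δ * V x + b * (Metric.closedBall (0 : EuclideanSpace ℝ (Fin d)) K).indicator 1 x
  finite_integral : ∀ n (x : M.Ehat n) (t : ℝ), 0 ≤ t →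
    ∫⁻ ω, (∫⁻ s in Set.Icc (0 : ℝ) t, ENNReal.ofReal
      (((1 + ‖(M.toHat n (X n s ω)).1‖) ^ 4 * V (M.toHat n (X n s ω))) ^ 2))
        ∂P n (M.ofHat n x) < ⊤

end

/-! ### Feller's iteration and the integrated Foster-Lyapunov inequality -/

section TransitionFunction

variable {S : Type*}

/-! The generator of the scaled chain is close to the diffusion generator when applied to `V`. A
second order Taylor expansion over one jump reproduces the drift and the diffusion term exactly, up
to two errors: the diffusion matrix is frozen at the origin, and the Hessian varies along a jump of
length at most `lbar / √n`. The derivative bound on `V` makes both errors at most a constant times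
`V / √n`, so for large `n` half of the decay rate absorbs them (`ChainSeq.eventually_drift`).

The drift inequality is then integrated in time without localization or martingales. The transition
function is the increasing limit of Feller's iterates, and the integrated inequality passes from
each iterate to the next by conditioning on the first jump (`renewal_add_lintegral_le`); monotone
convergence finishes (`tsum_transProb_mul_add_le`). All of this happens in `ℝ≥0∞`, with the drift
inequality rearranged to have no subtraction, so integrability is a consequence and not a
prerequisite.

Dropping the nonnegative terminal term bounds the time integral of the mean of `V` by a constant
plus `2b/δ` times the time. If `V` has finite sublevel sets on the state space, the time averages
are therefore tight, and a limit point is invariant (`IsMarkovSemigroup.exists_isInvariantProb`). An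
invariant law attracts every initial state: the mass common to the law at time `t` and to the
invariant law never decreases, and it grows by a fixed amount per unit of time while it stays away
from one (`IsMarkovSemigroup.eventually_one_le_overlap_add`). Periodicity cannot interfere, because
all transition probabilities are positive at every positive time. The same linear bound, applied to
truncations of `V`, controls the steady-state means
(`HasTransition.lintegral_le_of_isSteadyStateDist`). -/

theorem exitRate_nonneg (q : S → S → ℝ≥0) (x : S) : 0 ≤ exitRate q x :=
  tsum_nonneg fun _ => NNReal.coe_nonneg _

theorem ofReal_exitRate (q : S → S → ℝ≥0) {x : S} (hq : Summable (q x)) :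
    ENNReal.ofReal (exitRate q x) = ∑' z, (q x z : ℝ≥0∞) := by
  rw [exitRate, ENNReal.ofReal_tsum_of_nonneg (fun _ => NNReal.coe_nonneg _)
    (NNReal.summable_coe.2 hq)]
  simp

/-- Total probability for an exponential clock: either it has not rung by time `t`, or it rings at
some earlier time. -/
theorem ofReal_exp_neg_add_lintegral {r t : ℝ} (hr : 0 ≤ r) (ht : 0 ≤ t) :
    ENNReal.ofReal (Real.exp (-(r * t))) +
      ENNReal.ofReal r * ∫⁻ s in Set.Icc (0 : ℝ) t, ENNReal.ofReal (Real.exp (-(r * s))) = 1 := by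
  have hder : ∀ s ∈ Set.uIcc 0 t,
      HasDerivAt (fun s => -Real.exp (-(r * s))) (r * Real.exp (-(r * s))) s := by
    intro s _
    have := (((hasDerivAt_id s).const_mul r).neg.exp).neg
    refine this.congr_deriv ?_
    simp [mul_comm]
  have hcont : Continuous fun s : ℝ => r * Real.exp (-(r * s)) := by fun_prop
  have hint := intervalIntegral.integral_eq_sub_of_hasDerivAt hder (hcont.intervalIntegrable 0 t)
  rw [intervalIntegral.integral_of_le ht, ← integral_Icc_eq_integral_Ioc] at hint
  rw [← lintegral_const_mul' _ _ ENNReal.ofReal_ne_top]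
  simp_rw [← ENNReal.ofReal_mul hr]
  rw [← ofReal_integral_eq_lintegral_ofReal hcont.integrableOn_Icc
    (Eventually.of_forall fun s => by positivity), hint, ← ENNReal.ofReal_add (by positivity)]
  · simp
  · simpa using mul_nonneg hr ht

/-- The time before the first jump and the time remaining after it add up to `t` on average. This is
what makes the constant part of the drift contribute exactly linearly in `renewal_add_lintegral_le`.
-/
theorem lintegral_exp_neg_mul_one_add {r t : ℝ} (hr : 0 ≤ r) (ht : 0 ≤ t) :
    ∫⁻ s in Set.Icc (0 : ℝ) t, ENNReal.ofReal (Real.exp (-(r * s))) *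
      (1 + ENNReal.ofReal r * ENNReal.ofReal (t - s)) = ENNReal.ofReal t := by
  have hder : ∀ s ∈ Set.uIcc 0 t, HasDerivAt (fun s => -(Real.exp (-(r * s)) * (t - s)))
      (Real.exp (-(r * s)) * (1 + r * (t - s))) s := by
    intro s _
    have := ((((hasDerivAt_id s).const_mul r).neg.exp).mul ((hasDerivAt_id s).const_sub t)).neg
    refine this.congr_deriv ?_
    simp
    ring
  have hcont : Continuous fun s : ℝ => Real.exp (-(r * s)) * (1 + r * (t - s)) := by fun_prop
  have hint := intervalIntegral.integral_eq_sub_of_hasDerivAt hder (hcont.intervalIntegrable 0 t)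
  rw [intervalIntegral.integral_of_le ht, ← integral_Icc_eq_integral_Ioc] at hint
  have hpos : ∀ s ∈ Set.Icc (0 : ℝ) t, 0 ≤ r * (t - s) := fun s hs =>
    mul_nonneg hr (sub_nonneg.2 hs.2)
  rw [setLIntegral_congr_fun (g := fun s => ENNReal.ofReal (Real.exp (-(r * s)) *
      (1 + r * (t - s)))) measurableSet_Icc]
  · rw [← ofReal_integral_eq_lintegral_ofReal hcont.integrableOn_Icc, hint]
    · simp
    · filter_upwards [ae_restrict_mem measurableSet_Icc] with s hs
      have := hpos s hs
      positivity
  · intro s hs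
    have := hpos s hs
    simp only
    rw [ENNReal.ofReal_mul (by positivity), ENNReal.ofReal_add zero_le_one this,
      ENNReal.ofReal_mul hr, ENNReal.ofReal_one]

/-- Tonelli's theorem for convolutions on an interval. -/
theorem lintegral_lintegral_convolution {e w : ℝ → ℝ≥0∞} (he : Measurable e) (hw : Measurable w)
    (t : ℝ) :
    ∫⁻ r in Set.Icc (0 : ℝ) t, ∫⁻ s in Set.Icc (0 : ℝ) r, e s * w (r - s) =
      ∫⁻ s in Set.Icc (0 : ℝ) t, e s * ∫⁻ r in Set.Icc (0 : ℝ) (t - s), w r := by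
  let T : Set (ℝ × ℝ) := {p | 0 ≤ p.2 ∧ p.2 ≤ p.1 ∧ p.1 ≤ t}
  have hT : MeasurableSet T :=
    (measurableSet_le measurable_const measurable_snd).inter
      ((measurableSet_le measurable_snd measurable_fst).inter
        (measurableSet_le measurable_fst measurable_const))
  have hg : Measurable (T.indicator fun p : ℝ × ℝ => e p.2 * w (p.1 - p.2)) :=
    ((he.comp measurable_snd).mul (hw.comp (measurable_fst.sub measurable_snd))).indicator hT
  have h1 : ∫⁻ r in Set.Icc (0 : ℝ) t, ∫⁻ s in Set.Icc (0 : ℝ) r, e s * w (r - s) =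
      ∫⁻ r, ∫⁻ s, T.indicator (fun p : ℝ × ℝ => e p.2 * w (p.1 - p.2)) (r, s) := by
    rw [← lintegral_indicator measurableSet_Icc]
    refine lintegral_congr fun r => ?_
    by_cases hr : r ∈ Set.Icc (0 : ℝ) t
    · rw [Set.indicator_of_mem hr, ← lintegral_indicator measurableSet_Icc]
      refine lintegral_congr fun s => ?_
      by_cases hs : s ∈ Set.Icc (0 : ℝ) r
      · rw [Set.indicator_of_mem hs, Set.indicator_of_mem (show (r, s) ∈ T from
          ⟨hs.1, hs.2, hr.2⟩)]
      · rw [Set.indicator_of_notMem hs, Set.indicator_of_notMem]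
        exact fun h => hs ⟨h.1, h.2.1⟩
    · rw [Set.indicator_of_notMem hr]
      refine (lintegral_eq_zero_of_ae_eq_zero (Eventually.of_forall fun s =>
        Set.indicator_of_notMem ?_ _)).symm
      exact fun h => hr ⟨h.1.trans h.2.1, h.2.2⟩
  rw [h1, lintegral_lintegral_swap (f := fun r s => T.indicator
    (fun p : ℝ × ℝ => e p.2 * w (p.1 - p.2)) (r, s)) hg.aemeasurable, ← lintegral_indicator measurableSet_Icc]
  refine lintegral_congr fun s => ?_
  by_cases hs : s ∈ Set.Icc (0 : ℝ) t
  · rw [Set.indicator_of_mem hs, ← lintegral_indicator measurableSet_Icc,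
      ← lintegral_add_right_eq_self _ s, ← lintegral_const_mul _ (hw.indicator measurableSet_Icc)]
    · refine lintegral_congr fun r => ?_
      by_cases hr : r ∈ Set.Icc 0 (t - s)
      · rw [Set.indicator_of_mem hr, Set.indicator_of_mem]
        · simp
        · exact ⟨hs.1, le_add_of_nonneg_left hr.1, le_sub_iff_add_le.1 hr.2⟩
      · rw [Set.indicator_of_notMem hr, Set.indicator_of_notMem, mul_zero]
        exact fun h => hr ⟨nonneg_of_le_add_left h.2.1, le_sub_iff_add_le.2 h.2.2⟩
  · rw [Set.indicator_of_notMem hs]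
    refine lintegral_eq_zero_of_ae_eq_zero (Eventually.of_forall fun r =>
      Set.indicator_of_notMem ?_ _)
    exact fun h => hs ⟨h.1, h.2.1.trans h.2.2⟩

/-- The parameter also sits in the domain of integration; the indicator of a measurable wedge moves
it into the integrand. -/
theorem measurable_lintegral_Icc {g : ℝ → ℝ → ℝ≥0∞} (hg : Measurable (Function.uncurry g)) :
    Measurable fun t : ℝ => ∫⁻ s in Set.Icc (0 : ℝ) t, g t s := by
  let T : Set (ℝ × ℝ) := {p | 0 ≤ p.2 ∧ p.2 ≤ p.1}
  have hT : MeasurableSet T :=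
    (measurableSet_le measurable_const measurable_snd).inter
      (measurableSet_le measurable_snd measurable_fst)
  have h : Measurable fun t : ℝ => ∫⁻ s, T.indicator (Function.uncurry g) (t, s) :=
    (hg.indicator hT).lintegral_prod_right'
  convert h using 2 with t
  rw [← lintegral_indicator measurableSet_Icc]
  rfl

variable (q : S → S → ℝ≥0)

theorem measurable_transAux [Countable S] (k : ℕ) (x y : S) : Measurable fun t => transAux q k t x y := by
  classical
  have h0 : ∀ x y : S, Measurable fun t => if x = y then
      ENNReal.ofReal (Real.exp (-(exitRate q x * t))) else 0 := by
    intro x y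
    split_ifs
    · fun_prop
    · fun_prop
  induction k generalizing x with
  | zero =>
    convert h0 x y using 2 with t
    simp [transAux]
  | succ k ih =>
    have : Measurable fun t : ℝ => ∫⁻ s in Set.Icc (0 : ℝ) t,
        ENNReal.ofReal (Real.exp (-(exitRate q x * s))) *
          ∑' z, (q x z : ℝ≥0∞) * transAux q k (t - s) z y := by
      apply measurable_lintegral_Icc (g := fun t s =>
        ENNReal.ofReal (Real.exp (-(exitRate q x * s))) *
          ∑' z, (q x z : ℝ≥0∞) * transAux q k (t - s) z y)
      refine Measurable.mul (by fun_prop) (Measurable.tsum fun z => ?_)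
      exact ((ih z).comp (measurable_fst.sub measurable_snd)).const_mul _
    convert (h0 x y).add this using 2 with t
    simp [transAux]

theorem measurable_transProb [Countable S] (x y : S) : Measurable fun t => transProb q t x y :=
  Measurable.iSup fun k => measurable_transAux q k x y

theorem transAux_mono_succ (k : ℕ) (t : ℝ) (x y : S) :
    transAux q k t x y ≤ transAux q (k + 1) t x y := by
  induction k generalizing t x with
  | zero => rw [transAux, transAux]; exact le_self_add
  | succ k ih =>
    rw [transAux, transAux]
    gcongr
    exact ih _ _

theorem monotone_transAux (t : ℝ) (x y : S) : Monotone fun k => transAux q k t x y :=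
  monotone_nat_of_le_succ fun k => transAux_mono_succ q k t x y

/-- First-jump decomposition after testing against `f`; this puts the iterates in the form required
by `renewal_add_lintegral_le`. -/
theorem tsum_transAux_succ_mul [Countable S] (f : S → ℝ≥0∞) (k : ℕ) (t : ℝ) (x : S) :
    ∑' y, transAux q (k + 1) t x y * f y =
      ENNReal.ofReal (Real.exp (-(exitRate q x * t))) * f x +
        ∫⁻ s in Set.Icc (0 : ℝ) t, ENNReal.ofReal (Real.exp (-(exitRate q x * s))) *
          ∑' z, (q x z : ℝ≥0∞) * ∑' y, transAux q k (t - s) z y * f y := by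
  classical
  have hm : ∀ y, Measurable fun s : ℝ => ENNReal.ofReal (Real.exp (-(exitRate q x * s))) *
          ∑' z, (q x z : ℝ≥0∞) * transAux q k (t - s) z y := fun y =>
    Measurable.mul (by fun_prop) (Measurable.tsum fun z =>
      ((measurable_transAux q k z y).comp (measurable_const.sub measurable_id)).const_mul _)
  simp_rw [transAux, add_mul]
  rw [ENNReal.tsum_add]
  congr 1
  · rw [tsum_eq_single x]
    · simp
    · intro y hy
      simp [hy.symm]
  · simp_rw [← lintegral_mul_const _ (hm _)]
    rw [← lintegral_tsum fun y => ((hm y).mul_const _).aemeasurable]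
    refine lintegral_congr fun s => ?_
    simp_rw [mul_assoc, ENNReal.tsum_mul_left]
    congr 1
    simp_rw [← ENNReal.tsum_mul_right, ← ENNReal.tsum_mul_left]
    rw [ENNReal.tsum_comm]
    simp_rw [mul_assoc]

/-- One step of Feller's iteration preserves the integrated Foster-Lyapunov inequality. -/
theorem renewal_add_lintegral_le [Countable S] {f : S → ℝ≥0∞} {b c : ℝ≥0∞} {x : S}
    (hf : ∑' z, (q x z : ℝ≥0∞) * f z + c * f x ≤ ENNReal.ofReal (exitRate q x) * f x + b)
    (hq : Summable (q x)) {w : ℝ → S → ℝ≥0∞} (hw : ∀ z, Measurable fun t => w t z)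
    (hwf : ∀ z, ∀ t : ℝ, 0 ≤ t →
      w t z + c * ∫⁻ s in Set.Icc (0 : ℝ) t, w s z ≤ f z + b * ENNReal.ofReal t)
    {u : ℝ → ℝ≥0∞} (hu : ∀ t, u t = ENNReal.ofReal (Real.exp (-(exitRate q x * t))) * f x +
        ∫⁻ s in Set.Icc (0 : ℝ) t, ENNReal.ofReal (Real.exp (-(exitRate q x * s))) *
          ∑' z, (q x z : ℝ≥0∞) * w (t - s) z) {t : ℝ} (ht : 0 ≤ t) :
    u t + c * ∫⁻ s in Set.Icc (0 : ℝ) t, u s ≤ f x + b * ENNReal.ofReal t := by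
  set r := exitRate q x with hr
  have hr0 : 0 ≤ r := exitRate_nonneg q x
  set e : ℝ → ℝ≥0∞ := fun s => ENNReal.ofReal (Real.exp (-(r * s))) with he
  have hem : Measurable e := by fun_prop
  set Q : ℝ → ℝ≥0∞ := fun s => ∑' z, (q x z : ℝ≥0∞) * w s z with hQ
  have hQm : Measurable Q := Measurable.tsum fun z => (hw z).const_mul _
  have hsub : ∀ t, Measurable fun s => Q (t - s) := fun t =>
    hQm.comp (measurable_const.sub measurable_id)
  have hQi : ∀ s, Q s + c * ∫⁻ a in Set.Icc (0 : ℝ) s, Q a =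
      ∑' z, (q x z : ℝ≥0∞) * (w s z + c * ∫⁻ a in Set.Icc (0 : ℝ) s, w a z) := by
    intro s
    simp only [hQ]
    rw [lintegral_tsum fun z => ((hw z).const_mul _).aemeasurable]
    simp_rw [mul_add]
    rw [ENNReal.tsum_add, ← ENNReal.tsum_mul_left]
    congr 2 with z
    rw [lintegral_const_mul _ (hw z)]
    ring
  -- If the first jump occurs at time `s`, the bound on `w` applies with remaining time `t - s`. The
  -- extra `c * f x` is the term that lets the drift inequality at `x` be used.
  have hQle : ∀ s ∈ Set.Icc 0 t, c * f x + (Q (t - s) + c * ∫⁻ a in Set.Icc (0 : ℝ) (t - s), Q a) ≤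
      ENNReal.ofReal r * f x + b * (1 + ENNReal.ofReal r * ENNReal.ofReal (t - s)) := by
    intro s hs
    rw [hQi]
    calc c * f x + ∑' z, (q x z : ℝ≥0∞) *
          (w (t - s) z + c * ∫⁻ a in Set.Icc (0 : ℝ) (t - s), w a z)
        ≤ c * f x + ∑' z, (q x z : ℝ≥0∞) * (f z + b * ENNReal.ofReal (t - s)) := by
          gcongr c * f x + ?_
          exact ENNReal.tsum_le_tsum fun z => mul_le_mul_right (hwf z _ (sub_nonneg.2 hs.2)) _
      _ = (∑' z, (q x z : ℝ≥0∞) * f z + c * f x) +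
            ENNReal.ofReal r * (b * ENNReal.ofReal (t - s)) := by
          simp_rw [mul_add]
          rw [ENNReal.tsum_add, ENNReal.tsum_mul_right, ← ofReal_exitRate q hq]
          ring
      _ ≤ (ENNReal.ofReal r * f x + b) + ENNReal.ofReal r * (b * ENNReal.ofReal (t - s)) := by
          gcongr
      _ = _ := by ring
  have hI : ∫⁻ a in Set.Icc (0 : ℝ) t, u a = (∫⁻ s in Set.Icc (0 : ℝ) t, e s) * f x +
      ∫⁻ s in Set.Icc (0 : ℝ) t, e s * ∫⁻ a in Set.Icc (0 : ℝ) (t - s), Q a := by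
    simp_rw [hu]
    rw [lintegral_add_left (hem.mul_const _), lintegral_mul_const _ hem]
    congr 1
    exact lintegral_lintegral_convolution hem hQm t
  have hIm : Measurable fun s => ∫⁻ a in Set.Icc (0 : ℝ) (t - s), Q a :=
    (measurable_lintegral_Icc (g := fun _ a => Q a) (hQm.comp measurable_snd)).comp
      (measurable_const.sub measurable_id)
  have hut : u t = e t * f x + ∫⁻ s in Set.Icc (0 : ℝ) t, e s * Q (t - s) := hu t
  calc u t + c * ∫⁻ s in Set.Icc (0 : ℝ) t, u s
      = e t * f x + ∫⁻ s in Set.Icc (0 : ℝ) t, e s *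
          (c * f x + (Q (t - s) + c * ∫⁻ a in Set.Icc (0 : ℝ) (t - s), Q a)) := by
        simp_rw [mul_add (e _)]
        rw [lintegral_add_left (hem.mul_const _), lintegral_add_left (f := fun s => e s * Q (t - s))
          (hem.mul (hsub t)), hI, hut, lintegral_mul_const _ hem]
        simp_rw [mul_left_comm _ c]
        rw [lintegral_const_mul (f := fun s => e s * ∫⁻ a in Set.Icc (0 : ℝ) (t - s), Q a) c
          (hem.mul hIm)]
        ring
    _ ≤ e t * f x + ∫⁻ s in Set.Icc (0 : ℝ) t, e s *
          (ENNReal.ofReal r * f x + b * (1 + ENNReal.ofReal r * ENNReal.ofReal (t - s))) := by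
        refine add_le_add_right (setLIntegral_mono' measurableSet_Icc fun s hs => ?_) _
        exact mul_le_mul_right (hQle s hs) _
    _ = (e t + ENNReal.ofReal r * ∫⁻ s in Set.Icc (0 : ℝ) t, e s) * f x +
          b * ∫⁻ s in Set.Icc (0 : ℝ) t, e s *
            (1 + ENNReal.ofReal r * ENNReal.ofReal (t - s)) := by
        simp_rw [mul_add (e _)]
        rw [lintegral_add_left (hem.mul_const _), lintegral_mul_const _ hem]
        simp_rw [mul_left_comm _ b]
        rw [lintegral_const_mul _ (by fun_prop)]
        simp_rw [mul_add]
        ring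
    _ = f x + b * ENNReal.ofReal t := by
        rw [ofReal_exp_neg_add_lintegral hr0 ht, lintegral_exp_neg_mul_one_add hr0 ht, one_mul]

theorem measurable_tsum_transAux_mul [Countable S] (f : S → ℝ≥0∞) (k : ℕ) (x : S) :
    Measurable fun t => ∑' y, transAux q k t x y * f y :=
  Measurable.tsum fun y => (measurable_transAux q k x y).mul_const _

theorem tsum_transAux_mul_add_le [Countable S] {f : S → ℝ≥0∞} {b c : ℝ≥0∞}
    (hq : ∀ x, Summable (q x))
    (hf : ∀ x, ∑' z, (q x z : ℝ≥0∞) * f z + c * f x ≤ ENNReal.ofReal (exitRate q x) * f x + b)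
    (k : ℕ) (x : S) {t : ℝ} (ht : 0 ≤ t) :
    ∑' y, transAux q k t x y * f y + c * ∫⁻ s in Set.Icc (0 : ℝ) t, ∑' y, transAux q k s x y * f y
      ≤ f x + b * ENNReal.ofReal t := by
  classical
  induction k generalizing x t with
  | zero =>
    -- Allowing no jump is the renewal equation with everything after the first jump discarded.
    refine renewal_add_lintegral_le q (hf x) (hq x) (w := 0)
      (u := fun t => ∑' y, transAux q 0 t x y * f y) (fun _ => measurable_zero)
      (by simp) (fun t => ?_) ht
    rw [tsum_eq_single x]
    · simp [transAux]
    · intro y hy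
      simp [transAux, hy.symm]
  | succ k ih =>
    exact renewal_add_lintegral_le q (hf x) (hq x)
      (u := fun t => ∑' y, transAux q (k + 1) t x y * f y)
      (w := fun t z => ∑' y, transAux q k t z y * f y)
      (fun z => measurable_tsum_transAux_mul q f k z) (fun z t ht => ih z ht)
      (tsum_transAux_succ_mul q f k · x) ht

theorem tsum_transProb_mul (f : S → ℝ≥0∞) (t : ℝ) (x : S) :
    ∑' y, transProb q t x y * f y = ⨆ k, ∑' y, transAux q k t x y * f y := by
  simp_rw [transProb, ENNReal.iSup_mul, ENNReal.tsum_eq_iSup_sum]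
  rw [iSup_comm]
  refine iSup_congr fun s => ?_
  exact ENNReal.finsetSum_iSup_of_monotone fun y i j hij =>
    mul_le_mul_left (monotone_transAux q t x y hij) _

/-- The integrated Foster-Lyapunov inequality for the transition function. -/
theorem tsum_transProb_mul_add_le [Countable S] {f : S → ℝ≥0∞} {b c : ℝ≥0∞}
    (hq : ∀ x, Summable (q x))
    (hf : ∀ x, ∑' z, (q x z : ℝ≥0∞) * f z + c * f x ≤ ENNReal.ofReal (exitRate q x) * f x + b)
    (x : S) {t : ℝ} (ht : 0 ≤ t) :
    ∑' y, transProb q t x y * f y +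
      c * ∫⁻ s in Set.Icc (0 : ℝ) t, ∑' y, transProb q s x y * f y ≤
        f x + b * ENNReal.ofReal t := by
  have hmono : ∀ s, Monotone fun k => ∑' y, transAux q k s x y * f y := fun s i j hij =>
    ENNReal.tsum_le_tsum fun y => mul_le_mul_left (monotone_transAux q s x y hij) _
  simp_rw [tsum_transProb_mul]
  rw [lintegral_iSup (fun k => measurable_tsum_transAux_mul q f k x) fun i j hij s => hmono s hij,
    ENNReal.mul_iSup, ENNReal.iSup_add_iSup_of_monotone (hmono t)]
  · exact iSup_le fun k => tsum_transAux_mul_add_le q hq hf k x ht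
  · intro i j hij
    exact mul_le_mul_right (lintegral_mono fun s => hmono s hij) _

/-- Induction along the path, adding its edges from the front: each edge integrates a positive
integrand over the possible jump times in `(0, t)`. One bound on the number of jumps serves all
positive times, as the induction requires. -/
theorem transProb_pos [Countable S] {x y : S}
    (h : Relation.ReflTransGen (fun u v => 0 < q u v) x y) {t : ℝ} (ht : 0 < t) :
    0 < transProb q t x y := by
  classical
  suffices ∃ k, ∀ t : ℝ, 0 < t → 0 < transAux q k t x y by
    obtain ⟨k, hk⟩ := this
    exact (hk t ht).trans_le (le_iSup (fun k => transAux q k t x y) k)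
  induction h using Relation.ReflTransGen.head_induction_on with
  | refl => exact ⟨0, fun t _ => by simp [transAux, Real.exp_pos]⟩
  | @head x z hxz _ ih =>
    obtain ⟨k, hk⟩ := ih
    refine ⟨k + 1, fun t ht => ?_⟩
    rw [transAux]
    refine lt_of_lt_of_le ?_ le_add_self
    have hm : Measurable fun s : ℝ => ENNReal.ofReal (Real.exp (-(exitRate q x * s))) *
        ∑' z, (q x z : ℝ≥0∞) * transAux q k (t - s) z y :=
      Measurable.mul (by fun_prop) (Measurable.tsum fun z =>
        ((measurable_transAux q k z y).comp (measurable_const.sub measurable_id)).const_mul _)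
    rw [setLIntegral_pos_iff hm]
    refine lt_of_lt_of_le ?_ (measure_mono (s := Set.Ioo 0 t) fun s hs => ⟨?_, hs.1.le, hs.2.le⟩)
    · simpa using ht
    · refine (ENNReal.mul_pos (by simp [Real.exp_pos]) ?_).ne'
      refine ((ENNReal.mul_pos ?_ (hk (t - s) (sub_pos.2 hs.2)).ne').trans_le
        (ENNReal.le_tsum z)).ne'
      simpa using hxz.ne'

end TransitionFunction

/-! ### Convergence to, and existence of, invariant laws -/

section MarkovSemigroup

variable {S : Type*}

/-- Transition functions of irreducible Markov semigroups on a countable state space. -/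
structure IsMarkovSemigroup (p : ℝ → S → S → ℝ≥0∞) : Prop where
  tsum_eq_one : ∀ t, 0 ≤ t → ∀ x, ∑' y, p t x y = 1
  comp : ∀ s t, 0 ≤ s → 0 ≤ t → ∀ x z, p (s + t) x z = ∑' y, p s x y * p t y z
  pos : ∀ t, 0 < t → ∀ x y, 0 < p t x y

/-- `π` is an invariant probability vector of the semigroup `p`. -/
structure IsInvariantProb (p : ℝ → S → S → ℝ≥0∞) (π : S → ℝ≥0∞) : Prop where
  tsum_eq_one : ∑' x, π x = 1
  invariant : ∀ t, 0 ≤ t → ∀ y, ∑' x, π x * p t x y = π y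

/-- The common mass of two vectors. -/
noncomputable def overlap (a π : S → ℝ≥0∞) : ℝ≥0∞ := ∑' y, min (a y) (π y)

theorem tsum_tsum_mul_eq {K : S → S → ℝ≥0∞} (hK : ∀ x, ∑' y, K x y = 1) (a : S → ℝ≥0∞) :
    ∑' y, ∑' x, a x * K x y = ∑' x, a x := by
  rw [ENNReal.tsum_comm]
  simp_rw [ENNReal.tsum_mul_left, hK, mul_one]

/-- Split `a` and `π` into their common part and their surpluses. The kernel transports the common
part without loss of mass, and by invariance it remains common to both images; wherever the
transported surpluses meet, new common mass appears. -/
theorem overlap_add_min_le {K : S → S → ℝ≥0∞} (hK : ∀ x, ∑' y, K x y = 1) {π : S → ℝ≥0∞}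
    (hπ : ∀ y, ∑' x, π x * K x y = π y) (a : S → ℝ≥0∞) (z : S) :
    overlap a π + min (∑' x, (a x - min (a x) (π x)) * K x z)
      (∑' x, (π x - min (a x) (π x)) * K x z) ≤ overlap (fun y => ∑' x, a x * K x y) π := by
  have h : ∀ b : S → ℝ≥0∞, (∀ x, min (a x) (π x) ≤ b x) → ∀ y, ∑' x, b x * K x y =
      ∑' x, min (a x) (π x) * K x y + ∑' x, (b x - min (a x) (π x)) * K x y := by
    intro b hb y
    rw [← ENNReal.tsum_add]
    refine tsum_congr fun x => ?_
    rw [← add_mul, add_tsub_cancel_of_le (hb x)]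
  have key : overlap (fun y => ∑' x, a x * K x y) π = overlap a π +
      ∑' y, min (∑' x, (a x - min (a x) (π x)) * K x y)
        (∑' x, (π x - min (a x) (π x)) * K x y) := by
    rw [overlap, overlap, ← tsum_tsum_mul_eq hK (fun x => min (a x) (π x)), ← ENNReal.tsum_add]
    refine tsum_congr fun y => ?_
    rw [← min_add_add_left, ← h a (fun x => min_le_left _ _), ← h π (fun x => min_le_right _ _),
      hπ]
  rw [key]
  gcongr
  exact ENNReal.le_tsum z

theorem overlap_le_overlap_step {K : S → S → ℝ≥0∞} (hK : ∀ x, ∑' y, K x y = 1) {π : S → ℝ≥0∞}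
    (hπ : ∀ y, ∑' x, π x * K x y = π y) (a : S → ℝ≥0∞) :
    overlap a π ≤ overlap (fun y => ∑' x, a x * K x y) π := by
  rcases isEmpty_or_nonempty S with h | ⟨⟨z⟩⟩
  · simp [overlap]
  · exact le_self_add.trans (overlap_add_min_le hK hπ a z)

/-- A strictly positive kernel puts a definite amount of mass on each state, uniformly over the
vectors of mass at least `ε` dominated by a given summable one. -/
theorem exists_pos_le_tsum_mul {κ : S → ℝ≥0∞} (hκ : ∀ x, 0 < κ x) {ρ : S → ℝ≥0∞}
    (hρ : ∑' x, ρ x ≠ ⊤) {ε : ℝ≥0∞} (hε : ε ≠ 0) (hε' : ε ≠ ⊤) :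
    ∃ η : ℝ≥0∞, 0 < η ∧ ∀ α : S → ℝ≥0∞, (∀ x, α x ≤ ρ x) → ε ≤ ∑' x, α x →
      η ≤ ∑' x, α x * κ x := by
  have hhalf : 0 < ε / 2 := ENNReal.half_pos hε
  -- Outside the finite set `A` the dominating vector has mass below `ε / 2`, so at least `ε / 2` of
  -- every admissible vector lies in `A`, where the kernel has a positive minimum.
  obtain ⟨A, hA⟩ := ((ENNReal.tendsto_tsum_compl_atTop_zero hρ).eventually
    (gt_mem_nhds hhalf)).exists
  obtain ⟨θ, hθ, hθA⟩ : ∃ θ : ℝ≥0∞, 0 < θ ∧ ∀ x ∈ A, θ ≤ κ x := by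
    rcases A.eq_empty_or_nonempty with rfl | hne
    · exact ⟨1, one_pos, by simp⟩
    · refine ⟨A.inf' hne κ, (Finset.lt_inf'_iff _).2 fun x _ => hκ x, fun x hx =>
        Finset.inf'_le _ hx⟩
  refine ⟨ε / 2 * θ, ENNReal.mul_pos hhalf.ne' hθ.ne', fun α hα hαε => ?_⟩
  have h1 : ε / 2 ≤ ∑ x ∈ A, α x := by
    refine ENNReal.le_of_add_le_add_right (ENNReal.div_ne_top hε' two_ne_zero) (?_ : _ + ε / 2 ≤ _)
    rw [ENNReal.add_halves]
    refine hαε.trans ?_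
    rw [← ENNReal.sum_add_tsum_compl A α]
    gcongr
    refine le_trans (ENNReal.tsum_le_tsum fun x => hα x) hA.le
  calc ε / 2 * θ ≤ (∑ x ∈ A, α x) * θ := by gcongr
    _ = ∑ x ∈ A, α x * θ := Finset.sum_mul ..
    _ ≤ ∑ x ∈ A, α x * κ x := Finset.sum_le_sum fun x hx => mul_le_mul_right (hθA x hx) _
    _ ≤ _ := ENNReal.sum_le_tsum A

namespace IsMarkovSemigroup

variable {p : ℝ → S → S → ℝ≥0∞} {π : S → ℝ≥0∞}

theorem invariantProb_pos (hp : IsMarkovSemigroup p) (hπ : IsInvariantProb p π) (y : S) :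
    0 < π y := by
  obtain ⟨x, hx⟩ : ∃ x, π x ≠ 0 := by
    by_contra! h
    have := hπ.tsum_eq_one
    simp [h] at this
  rw [← hπ.invariant 1 zero_le_one y]
  exact (ENNReal.mul_pos hx (hp.pos 1 one_pos x y).ne').trans_le
    (ENNReal.le_tsum (f := fun x => π x * p 1 x y) x)

theorem overlap_mono (hp : IsMarkovSemigroup p) (hπ : IsInvariantProb p π) (x : S) {s t : ℝ}
    (hs : 0 ≤ s) (hst : s ≤ t) : overlap (p s x) π ≤ overlap (p t x) π := by
  have h := overlap_le_overlap_step (hp.tsum_eq_one _ (sub_nonneg.2 hst))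
    (hπ.invariant _ (sub_nonneg.2 hst)) (p s x)
  simp_rw [← hp.comp s (t - s) hs (sub_nonneg.2 hst)] at h
  simpa using h

/-- Convergence in total variation of irreducible Markov semigroups with an invariant law. -/
theorem eventually_one_le_overlap_add (hp : IsMarkovSemigroup p) (hπ : IsInvariantProb p π)
    (x : S) {ε : ℝ≥0∞} (hε : ε ≠ 0) : ∀ᶠ t in atTop, 1 ≤ overlap (p t x) π + ε := by
  suffices ∃ n : ℕ, 1 ≤ overlap (p n x) π + ε by
    obtain ⟨n, hn⟩ := this
    filter_upwards [eventually_ge_atTop (n : ℝ)] with t ht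
    exact hn.trans (add_le_add_left (hp.overlap_mono hπ x n.cast_nonneg ht) _)
  by_contra! hcon
  have hε1 : ε ≤ 1 := le_add_self.trans (hcon 0).le
  have hε' : ε ≠ ⊤ := (hε1.trans_lt ENNReal.one_lt_top).ne
  have hx := hp.invariantProb_pos hπ x
  have hπ1 : ∀ y, π y ≤ 1 := fun y => hπ.tsum_eq_one ▸ ENNReal.le_tsum y
  have hxt : π x ≠ ⊤ := ((hπ1 x).trans_lt ENNReal.one_lt_top).ne
  -- Invariance gives `π x * p n x y ≤ π y`. All the laws `p n x` are thus dominated by one summable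
  -- vector, which makes the gain in overlap uniform in `n`.
  have hle : ∀ n : ℕ, ∀ y, p n x y ≤ (π x)⁻¹ * π y := by
    intro n y
    rw [mul_comm, ← div_eq_mul_inv, ENNReal.le_div_iff_mul_le (Or.inl hx.ne') (Or.inl hxt),
      ← hπ.invariant n n.cast_nonneg y, mul_comm]
    exact ENNReal.le_tsum (f := fun x => π x * p n x y) x
  have hfin : ∀ n : ℕ, overlap (p n x) π ≠ ⊤ := fun n =>
    ((le_self_add.trans (hcon n).le).trans_lt ENNReal.one_lt_top).ne
  obtain ⟨η₁, hη₁, h₁⟩ := exists_pos_le_tsum_mul (κ := fun y => p 1 y x)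
    (ρ := fun y => (π x)⁻¹ * π y) (fun y => hp.pos 1 one_pos y x)
    (by rw [ENNReal.tsum_mul_left, hπ.tsum_eq_one, mul_one]; exact ENNReal.inv_ne_top.2 hx.ne')
    hε hε'
  obtain ⟨η₂, hη₂, h₂⟩ := exists_pos_le_tsum_mul (κ := fun y => p 1 y x)
    (ρ := π) (fun y => hp.pos 1 one_pos y x)
    (by rw [hπ.tsum_eq_one]; exact ENNReal.one_ne_top) hε hε'
  have hsum : ∀ n : ℕ, ∀ b : S → ℝ≥0∞, (∀ y, min (p n x y) (π y) ≤ b y) → ∑' y, b y = 1 →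
      ε ≤ ∑' y, (b y - min (p n x y) (π y)) := by
    intro n b hb hb1
    refine ENNReal.le_of_add_le_add_left (hfin n) ((hcon n).le.trans ?_)
    rw [overlap, ← ENNReal.tsum_add, ← hb1]
    refine ENNReal.tsum_le_tsum fun y => ?_
    rw [add_tsub_cancel_of_le (hb y)]
  -- While the overlap stays below `1 - ε`, both surpluses have mass at least `ε`, and each sends a
  -- definite amount to the state `x` in unit time. The resulting linear growth contradicts the
  -- bound by one.
  have hstep : ∀ n : ℕ, overlap (p n x) π + min η₁ η₂ ≤ overlap (p (n + 1 : ℕ) x) π := by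
    intro n
    have h := overlap_add_min_le (hp.tsum_eq_one 1 zero_le_one) (hπ.invariant 1 zero_le_one)
      (p n x) x
    simp_rw [← hp.comp n 1 n.cast_nonneg zero_le_one] at h
    rw [Nat.cast_succ]
    refine le_trans ?_ h
    gcongr
    · exact h₁ _ (fun y => tsub_le_self.trans (hle n y))
        (hsum n _ (fun y => min_le_left _ _) (hp.tsum_eq_one n n.cast_nonneg x))
    · exact h₂ _ (fun y => tsub_le_self) (hsum n _ (fun y => min_le_right _ _) hπ.tsum_eq_one)
  have hlin : ∀ n : ℕ, n * min η₁ η₂ ≤ overlap (p n x) π := by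
    intro n
    induction n with
    | zero => simp
    | succ n ih =>
      refine le_trans ?_ (hstep n)
      rw [Nat.cast_succ, add_mul, one_mul]
      gcongr
  obtain ⟨n, hn⟩ := ENNReal.exists_nat_mul_gt (lt_min hη₁ hη₂).ne' ENNReal.one_ne_top
  exact absurd (hn.le.trans (hlin n)) (not_le.2 (le_self_add.trans_lt (hcon n)))

end IsMarkovSemigroup

/-- Pointwise, `|a - b| = a + b - 2 * min a b`, so the point masses differ by twice the missing
overlap in total. -/
theorem abs_integral_sub_integral_le_of_overlap [Countable S] [MeasurableSpace S]
    [MeasurableSingletonClass S] (μ ν : Measure S) [IsProbabilityMeasure μ]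
    [IsProbabilityMeasure ν] {ε B : ℝ} (hε : 0 ≤ ε)
    (h : 1 ≤ overlap (fun y => μ {y}) (fun y => ν {y}) + ENNReal.ofReal ε) {f : S → ℝ}
    (hf : ∀ y, |f y| ≤ B) (hB : 0 ≤ B) : |∫ y, f y ∂μ - ∫ y, f y ∂ν| ≤ 2 * B * ε := by
  have hint : ∀ κ : Measure S, IsProbabilityMeasure κ → Integrable f κ := fun κ _ =>
    Integrable.of_bound (measurable_of_countable f).aestronglyMeasurable B
      (Eventually.of_forall hf)
  have hone : ∀ κ : Measure S, IsProbabilityMeasure κ → HasSum (fun y => κ.real {y}) 1 := by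
    intro κ _
    have h1 : ∑' y, κ {y} = 1 := by
      have := lintegral_countable' (μ := κ) fun _ => 1
      simpa using this.symm
    have := ENNReal.hasSum_toReal (f := fun y => κ {y}) (by rw [h1]; exact ENNReal.one_ne_top)
    rwa [← ENNReal.tsum_toReal_eq (fun y => measure_ne_top _ _), h1, ENNReal.toReal_one] at this
  have hsum : ∀ κ : Measure S, IsProbabilityMeasure κ →
      HasSum (fun y => κ.real {y} * f y) (∫ y, f y ∂κ) := by
    intro κ hκ
    have h1 : Summable fun y => κ.real {y} * f y := by
      refine Summable.of_norm_bounded ((hone κ hκ).summable.mul_right B) fun y => ?_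
      rw [norm_mul, Real.norm_eq_abs, Real.norm_eq_abs, abs_of_nonneg measureReal_nonneg]
      exact mul_le_mul_of_nonneg_left (hf y) measureReal_nonneg
    have := h1.hasSum
    rwa [show ∑' y, κ.real {y} * f y = ∫ y, f y ∂κ by
      rw [integral_countable (hint κ hκ)]; simp] at this
  have hmin : overlap (fun y => μ {y}) (fun y => ν {y}) ≠ ⊤ := by
    refine ne_top_of_le_ne_top (?_ : ∑' y, μ {y} ≠ ⊤)
      (ENNReal.tsum_le_tsum fun y => min_le_left _ _)
    have := lintegral_countable' (μ := μ) fun _ => 1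
    simp only [lintegral_const, measure_univ, one_mul] at this
    rw [← this]
    exact ENNReal.one_ne_top
  have hm : HasSum (fun y => (min (μ {y}) (ν {y})).toReal)
      (overlap (fun y => μ {y}) (fun y => ν {y})).toReal := by
    have := ENNReal.hasSum_toReal hmin
    rwa [← ENNReal.tsum_toReal_eq (ENNReal.ne_top_of_tsum_ne_top hmin)] at this
  have habs := (((hone μ ‹_›).add (hone ν ‹_›)).sub (hm.mul_left 2)).mul_right B
  have hdiff := (hsum μ ‹_›).sub (hsum ν ‹_›)
  have hmass : 1 - ε ≤ (overlap (fun y => μ {y}) (fun y => ν {y})).toReal := by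
    have h2 := ENNReal.toReal_mono (ENNReal.add_ne_top.2 ⟨hmin, ENNReal.ofReal_ne_top⟩) h
    rw [ENNReal.toReal_add hmin ENNReal.ofReal_ne_top, ENNReal.toReal_ofReal hε] at h2
    simp at h2
    linarith
  have hpt : ∀ y, |μ.real {y} * f y - ν.real {y} * f y| ≤
      (μ.real {y} + ν.real {y} - 2 * (min (μ {y}) (ν {y})).toReal) * B := by
    intro y
    rw [ENNReal.toReal_min (measure_ne_top _ _) (measure_ne_top _ _)]
    change _ ≤ (_ + _ - 2 * min (μ.real {y}) (ν.real {y})) * B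
    rw [← sub_mul, abs_mul]
    have : |μ.real {y} - ν.real {y}| =
        μ.real {y} + ν.real {y} - 2 * min (μ.real {y}) (ν.real {y}) := by
      rcases le_total (μ.real {y}) (ν.real {y}) with h | h
      · rw [abs_of_nonpos (sub_nonpos.2 h), min_eq_left h]; ring
      · rw [abs_of_nonneg (sub_nonneg.2 h), min_eq_right h]; ring
    rw [this]
    refine mul_le_mul_of_nonneg_left (hf y) (this ▸ abs_nonneg _)
  have hle : |∫ y, f y ∂μ - ∫ y, f y ∂ν| ≤
      (1 + 1 - 2 * (overlap (fun y => μ {y}) (fun y => ν {y})).toReal) * B := by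
    rw [abs_le]
    constructor
    · exact hasSum_le (fun y => (abs_le.1 (hpt y)).1) habs.neg hdiff
    · exact hasSum_le (fun y => (abs_le.1 (hpt y)).2) hdiff habs
  refine hle.trans ?_
  nlinarith

theorem eq_of_le_of_tsum_eq_one {a b : S → ℝ≥0∞} (hab : ∀ y, a y ≤ b y) (ha : ∑' y, a y = 1)
    (hb : ∑' y, b y = 1) : a = b := by
  by_contra hne
  obtain ⟨y, hy⟩ := Function.ne_iff.1 hne
  have := ENNReal.tsum_lt_tsum (ha ▸ ENNReal.one_ne_top) hab (lt_of_le_of_ne (hab y) hy)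
  simp [ha, hb] at this

/-- Existence of an invariant law from tightness of the time averages. -/
theorem IsMarkovSemigroup.exists_isInvariantProb [Countable S] {p : ℝ → S → S → ℝ≥0∞}
    (hp : IsMarkovSemigroup p) (hpm : ∀ x y, Measurable fun t => p t x y) (x : S)
    {f : S → ℝ≥0∞} (hf : ∀ R : ℝ≥0, {y | f y ≤ R}.Finite) {B : ℝ≥0}
    (hB : ∀ T : ℝ, 1 ≤ T →
      ∫⁻ s in Set.Icc (0 : ℝ) T, ∑' y, p s x y * f y ≤ B * ENNReal.ofReal T) :
    ∃ π, IsInvariantProb p π := by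
  -- An ultrafilter finer than `atTop` gives limits of the time averages at all states
  -- simultaneously, by compactness of `ℝ≥0∞`, in place of a diagonal subsequence.
  set U : Ultrafilter ℝ := Ultrafilter.of atTop with hUdef
  have hU : (U : Filter ℝ) ≤ atTop := Ultrafilter.of_le _
  set μ : ℝ → S → ℝ≥0∞ := fun T y => (ENNReal.ofReal T)⁻¹ * ∫⁻ s in Set.Icc (0 : ℝ) T, p s x y
    with hμ
  set π : S → ℝ≥0∞ := fun y => (U.map fun T => μ T y).lim with hπdef
  have hlim : ∀ y, Tendsto (fun T => μ T y) U (𝓝 (π y)) := fun y =>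
    Ultrafilter.le_nhds_lim (U.map fun T => μ T y)
  have hT1 : ∀ᶠ T in (U : Filter ℝ), 1 ≤ T := hU (eventually_ge_atTop 1)
  have hT0 : ∀ T : ℝ, 1 ≤ T → (ENNReal.ofReal T) ≠ 0 := fun T hT => by
    simpa using zero_lt_one.trans_le hT
  have hμg : ∀ (T : ℝ) (g : S → ℝ≥0∞), ∑' y, μ T y * g y =
      (ENNReal.ofReal T)⁻¹ * ∫⁻ s in Set.Icc (0 : ℝ) T, ∑' y, p s x y * g y := by
    intro T g
    rw [lintegral_tsum fun y => ((hpm x y).mul_const _).aemeasurable, ← ENNReal.tsum_mul_left]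
    refine tsum_congr fun y => ?_
    rw [lintegral_mul_const _ (hpm x y), mul_assoc]
  have hμ1 : ∀ T : ℝ, 1 ≤ T → ∑' y, μ T y = 1 := by
    intro T hT
    have := hμg T fun _ => 1
    simp only [mul_one] at this
    rw [this, setLIntegral_congr_fun (g := fun _ => 1) measurableSet_Icc
      fun s hs => hp.tsum_eq_one s hs.1 x]
    simp only [lintegral_const, Measure.restrict_apply_univ, Real.volume_Icc, one_mul, sub_zero]
    exact ENNReal.inv_mul_cancel (hT0 T hT) ENNReal.ofReal_ne_top
  have hπ_le : ∑' y, π y ≤ 1 := by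
    rw [ENNReal.tsum_eq_iSup_sum]
    refine iSup_le fun A => ?_
    refine le_of_tendsto (tendsto_finsetSum A fun y _ => hlim y) ?_
    filter_upwards [hT1] with T hT
    exact (ENNReal.sum_le_tsum A).trans (hμ1 T hT).le
  -- Markov's inequality: each time average puts mass at most `B / R` outside the finite set where
  -- `f ≤ R`, so no more than that can escape in the limit.
  have hπ_ge : ∀ R : ℝ≥0, 0 < R → 1 ≤ ∑' y, π y + B / R := by
    intro R hR
    set A := (hf R).toFinset with hA
    refine le_trans ?_ (add_le_add_left (ENNReal.sum_le_tsum A) _)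
    refine ge_of_tendsto ((tendsto_finsetSum A fun y _ => hlim y).add_const _) ?_
    filter_upwards [hT1] with T hT
    rw [← hμ1 T hT, ← ENNReal.sum_add_tsum_compl A (μ T)]
    gcongr
    rw [ENNReal.le_div_iff_mul_le (Or.inl (by simpa using hR.ne')) (Or.inl ENNReal.coe_ne_top),
      ← ENNReal.tsum_mul_right]
    calc ∑' y : ↑((A : Set S)ᶜ), μ T y * R ≤ ∑' y : ↑((A : Set S)ᶜ), μ T y * f y := by
          refine ENNReal.tsum_le_tsum fun y => mul_le_mul_right ?_ _
          have := y.2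
          simp only [hA, Set.Finite.coe_toFinset, Set.mem_compl_iff, Set.mem_ofPred_eq,
            not_le] at this
          exact this.le
      _ ≤ ∑' y, μ T y * f y :=
          ENNReal.tsum_comp_le_tsum_of_injective Subtype.val_injective (fun y => μ T y * f y)
      _ ≤ (ENNReal.ofReal T)⁻¹ * (B * ENNReal.ofReal T) := by
          rw [hμg]
          gcongr
          exact hB T hT
      _ = B := by
          rw [mul_left_comm, ENNReal.inv_mul_cancel (hT0 T hT) ENNReal.ofReal_ne_top, mul_one]
  have hπ1 : ∑' y, π y = 1 := by
    refine le_antisymm hπ_le (ENNReal.le_of_forall_pos_le_add fun ε hε _ => ?_)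
    -- The level makes `B / R ≤ ε`; adding one keeps it positive when `B = 0`.
    refine (hπ_ge ((B + 1) / ε) (by positivity)).trans ?_
    gcongr
    refine ENNReal.div_le_of_le_mul ?_
    rw [← ENNReal.coe_mul, mul_div_cancel₀ _ hε.ne']
    exact_mod_cast le_self_add
  refine ⟨π, hπ1, fun h hh => ?_⟩
  -- Both vectors have mass one, so one inequality suffices. It is checked on finite partial sums,
  -- where the limit may be taken; shifting the averaging window by `h` costs at most `h / T`, which
  -- vanishes.
  refine congrFun (eq_of_le_of_tsum_eq_one (fun y => ?_) ?_ hπ1)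
  · rw [ENNReal.tsum_eq_iSup_sum]
    refine iSup_le fun A => ?_
    have hlim0 : Tendsto (fun T : ℝ => (ENNReal.ofReal T)⁻¹ * ENNReal.ofReal h) U (𝓝 0) := by
      have h1 : Tendsto (fun T : ℝ => (ENNReal.ofReal T)⁻¹) U (𝓝 0) := by
        have := (tendsto_inv_iff.2 (ENNReal.tendsto_ofReal_atTop)).mono_left hU
        simpa using this
      simpa using ENNReal.Tendsto.mul_const h1 (Or.inr ENNReal.ofReal_ne_top)
    have hl : Tendsto (fun T => ∑ x' ∈ A, μ T x' * p h x' y) U (𝓝 (∑ x' ∈ A, π x' * p h x' y)) :=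
      tendsto_finsetSum A fun x' _ => ENNReal.Tendsto.mul_const (hlim x') (Or.inr ?_)
    · have hr := (hlim y).add hlim0
      rw [add_zero] at hr
      refine le_of_tendsto_of_tendsto hl hr ?_
      filter_upwards [hT1] with T hT
      calc ∑ x' ∈ A, μ T x' * p h x' y ≤ ∑' x', μ T x' * p h x' y := ENNReal.sum_le_tsum A
        _ = (ENNReal.ofReal T)⁻¹ * ∫⁻ s in Set.Icc (0 : ℝ) T, p (s + h) x y := by
          rw [hμg]
          congr 1
          refine setLIntegral_congr_fun measurableSet_Icc fun s hs => ?_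
          exact (hp.comp s h hs.1 hh x y).symm
        _ ≤ (ENNReal.ofReal T)⁻¹ * ((∫⁻ s in Set.Icc (0 : ℝ) T, p s x y) + ENNReal.ofReal h) := by
          gcongr _ * ?_
          calc ∫⁻ s in Set.Icc (0 : ℝ) T, p (s + h) x y
              = ∫⁻ s in Set.Icc h (T + h), p s x y := by
                rw [← lintegral_indicator measurableSet_Icc,
                  ← lintegral_indicator measurableSet_Icc,
                  ← lintegral_add_right_eq_self ((Set.Icc h (T + h)).indicator _) h]
                refine lintegral_congr fun s => ?_
                simp [Set.indicator]
            _ ≤ ∫⁻ s in Set.Icc 0 T ∪ Set.Icc T (T + h), p s x y := by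
                refine lintegral_mono_set fun s hs => ?_
                rcases le_total s T with h' | h'
                · exact Or.inl ⟨hh.trans hs.1, h'⟩
                · exact Or.inr ⟨h', hs.2⟩
            _ ≤ (∫⁻ s in Set.Icc 0 T, p s x y) + ∫⁻ s in Set.Icc T (T + h), p s x y :=
                lintegral_union_le _ _ _
            _ ≤ (∫⁻ s in Set.Icc 0 T, p s x y) + ∫⁻ s in Set.Icc T (T + h), 1 := by
                refine add_le_add_right (setLIntegral_mono' measurableSet_Icc fun s hs => ?_) _
                rw [← hp.tsum_eq_one s (by linarith [hs.1]) x]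
                exact ENNReal.le_tsum y
            _ = _ := by simp
        _ = μ T y + (ENNReal.ofReal T)⁻¹ * ENNReal.ofReal h := mul_add _ _ _
    · refine ne_top_of_le_ne_top ENNReal.one_ne_top ?_
      rw [← hp.tsum_eq_one h hh x']
      exact ENNReal.le_tsum y
  · rw [tsum_tsum_mul_eq (hp.tsum_eq_one h hh), hπ1]

end MarkovSemigroup

/-! ### Second order Taylor bound along a segment -/

section Taylor

variable {H : Type*} [NormedAddCommGroup H] [NormedSpace ℝ H]

/-- Second order Taylor bound when the Hessian varies by at most `ε` along the segment. -/
theorem sub_le_taylor_two {V : H → ℝ} (hV : ContDiff ℝ 2 V) (x h : H) {ε : ℝ}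
    (hε : ∀ θ ∈ Set.Ioo (0 : ℝ) 1,
      fderiv ℝ (fderiv ℝ V) (x + θ • h) h h ≤ fderiv ℝ (fderiv ℝ V) x h h + ε) :
    V (x + h) ≤ V x + fderiv ℝ V x h + 1 / 2 * (fderiv ℝ (fderiv ℝ V) x h h + ε) := by
  set A := fderiv ℝ (fderiv ℝ V) x h h + ε
  have hV1 : ContDiff ℝ 1 (fderiv ℝ V) := hV.fderiv_right (by norm_num)
  have hline : ∀ θ : ℝ, HasDerivAt (fun θ : ℝ => x + θ • h) h θ := fun θ => by
    simpa using ((hasDerivAt_id θ).smul_const h).const_add x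
  have hg : ∀ θ : ℝ, HasDerivAt (fun θ : ℝ => V (x + θ • h)) (fderiv ℝ V (x + θ • h) h) θ :=
    fun θ => ((hV.differentiable (by norm_num)) _).hasFDerivAt.comp_hasDerivAt θ (hline θ)
  have hg' : ∀ θ : ℝ, HasDerivAt (fun θ : ℝ => fderiv ℝ V (x + θ • h) h)
      (fderiv ℝ (fderiv ℝ V) (x + θ • h) h h) θ := fun θ =>
    (((hV1.differentiable (by norm_num)) _).hasFDerivAt.comp_hasDerivAt θ (hline θ)).clm_apply
      (hasDerivAt_const θ h) |>.congr_deriv (by simp)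
  -- `k'` is the derivative of `k` and vanishes at zero. The Hessian bound makes `k'` decreasing,
  -- hence nonpositive, so `k` is decreasing as well, and `k 1 ≤ k 0` is the claim.
  set k' : ℝ → ℝ := fun θ => fderiv ℝ V (x + θ • h) h - fderiv ℝ V x h - A * θ with hk'
  set k : ℝ → ℝ := fun θ => V (x + θ • h) - fderiv ℝ V x h * θ - A * (θ ^ 2 / 2) with hk
  have hdk' : ∀ θ, HasDerivAt k' (fderiv ℝ (fderiv ℝ V) (x + θ • h) h h - A) θ := fun θ =>
    (((hg' θ).sub_const _).sub ((hasDerivAt_id θ).const_mul A)).congr_deriv (by simp)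
  have hdk : ∀ θ, HasDerivAt k (k' θ) θ := fun θ =>
    (((hg θ).sub ((hasDerivAt_id θ).const_mul _)).sub
      ((((hasDerivAt_id θ).pow 2).div_const 2).const_mul A)).congr_deriv (by simp [hk'])
  have hanti' : AntitoneOn k' (Set.Icc 0 1) := by
    refine antitoneOn_of_deriv_nonpos (convex_Icc 0 1)
      (fun θ _ => (hdk' θ).continuousAt.continuousWithinAt)
      (fun θ _ => (hdk' θ).differentiableAt.differentiableWithinAt) fun θ hθ => ?_
    rw [interior_Icc] at hθ
    rw [(hdk' θ).deriv]
    exact sub_nonpos.2 (hε θ hθ)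
  have hanti : AntitoneOn k (Set.Icc 0 1) := by
    refine antitoneOn_of_deriv_nonpos (convex_Icc 0 1)
      (fun θ _ => (hdk θ).continuousAt.continuousWithinAt)
      (fun θ _ => (hdk θ).differentiableAt.differentiableWithinAt) fun θ hθ => ?_
    rw [interior_Icc] at hθ
    rw [(hdk θ).deriv]
    have := hanti' (by simp) (Set.Ioo_subset_Icc_self hθ) hθ.1.le
    simpa [hk'] using this
  have := hanti (by simp) (by simp) (zero_le_one' ℝ)
  simp [hk] at this
  linarith

end Taylor

/-! ### Coordinates, matrix norms and the Hessian remainder -/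

section Euclidean

variable {d : ℕ}

theorem EuclideanSpace.eq_sum_single (h : EuclideanSpace ℝ (Fin d)) :
    h = ∑ i, h i • EuclideanSpace.single i (1 : ℝ) := by
  ext j
  simp [Finset.sum_apply, Pi.single_apply]

theorem linear_apply_eq_sum (D : EuclideanSpace ℝ (Fin d) →L[ℝ] ℝ)
    (h : EuclideanSpace ℝ (Fin d)) : D h = ∑ i, h i * D (EuclideanSpace.single i 1) := by
  conv_lhs => rw [EuclideanSpace.eq_sum_single h]
  simp

theorem bilinear_apply_eq_sum
    (D : EuclideanSpace ℝ (Fin d) →L[ℝ] EuclideanSpace ℝ (Fin d) →L[ℝ] ℝ)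
    (h : EuclideanSpace ℝ (Fin d)) :
    D h h = ∑ i, ∑ j, h i * h j * D (EuclideanSpace.single i 1) (EuclideanSpace.single j 1) := by
  rw [linear_apply_eq_sum (D h) h, Finset.sum_comm]
  refine Finset.sum_congr rfl fun j _ => ?_
  have := linear_apply_eq_sum (D.flip (EuclideanSpace.single j 1)) h
  simp only [ContinuousLinearMap.flip_apply] at this
  rw [this, Finset.mul_sum]
  refine Finset.sum_congr rfl fun i _ => ?_
  ring

theorem abs_le_matNorm (A : Matrix (Fin d) (Fin d) ℝ) (i j : Fin d) : |A i j| ≤ matNorm A := by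
  refine Real.abs_le_sqrt ?_
  refine le_trans ?_ (Finset.single_le_sum (f := fun i => ∑ j, A i j ^ 2)
    (fun i _ => Finset.sum_nonneg fun j _ => sq_nonneg _) (Finset.mem_univ i))
  exact Finset.single_le_sum (f := fun j => A i j ^ 2) (fun j _ => sq_nonneg _) (Finset.mem_univ j)

theorem sum_mul_bilinear_le (A : Matrix (Fin d) (Fin d) ℝ)
    (D : EuclideanSpace ℝ (Fin d) →L[ℝ] EuclideanSpace ℝ (Fin d) →L[ℝ] ℝ) :
    ∑ i, ∑ j, A i j * D (EuclideanSpace.single i 1) (EuclideanSpace.single j 1) ≤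
      d ^ 2 * (matNorm A * ‖D‖) := by
  calc ∑ i, ∑ j, A i j * D (EuclideanSpace.single i 1) (EuclideanSpace.single j 1)
      ≤ ∑ _i : Fin d, ∑ _j : Fin d, matNorm A * ‖D‖ := by
        refine Finset.sum_le_sum fun i _ => Finset.sum_le_sum fun j _ => ?_
        refine (le_abs_self _).trans ?_
        rw [abs_mul]
        refine mul_le_mul (abs_le_matNorm A i j) ?_ (abs_nonneg _) (Real.sqrt_nonneg _)
        simpa using D.le_opNorm₂ (EuclideanSpace.single i 1) (EuclideanSpace.single j 1)
    _ = _ := by simp; ring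

theorem norm_sub_le_lipHess {V : EuclideanSpace ℝ (Fin d) → ℝ} {B : Set (EuclideanSpace ℝ (Fin d))}
    (hB : lipHess V B ≠ ⊤) {y z : EuclideanSpace ℝ (Fin d)} (hy : y ∈ B) (hz : z ∈ B) :
    ‖fderiv ℝ (fderiv ℝ V) y - fderiv ℝ (fderiv ℝ V) z‖ ≤ (lipHess V B).toReal * ‖y - z‖ := by
  rcases eq_or_ne y z with rfl | hne
  · rw [sub_self, sub_self, norm_zero, mul_zero]
    exact (norm_zero (E := EuclideanSpace ℝ (Fin d) →L[ℝ] EuclideanSpace ℝ (Fin d) →L[ℝ] ℝ)).le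
  have h : edist (fderiv ℝ (fderiv ℝ V) y) (fderiv ℝ (fderiv ℝ V) z) / edist y z ≤ lipHess V B :=
    le_iSup₂_of_le y hy (le_iSup₂_of_le z hz le_rfl)
  rw [ENNReal.div_le_iff (by simpa using hne) (edist_ne_top _ _)] at h
  have := ENNReal.toReal_mono (ENNReal.mul_ne_top hB (edist_ne_top _ _)) h
  rwa [ENNReal.toReal_mul, ← dist_edist, ← dist_edist, dist_eq_norm, dist_eq_norm] at this

/-- Second order Taylor bound for jumps of size at most `ρ`. -/
theorem taylor_of_norm_le {V : EuclideanSpace ℝ (Fin d) → ℝ} (hV : ContDiff ℝ 2 V)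
    (x h : EuclideanSpace ℝ (Fin d)) {ρ : ℝ} (hB : lipHess V (Metric.ball x ρ) ≠ ⊤)
    (hh : ‖h‖ ≤ ρ) :
    V (x + h) ≤ V x + ∑ i, h i * fderiv ℝ V x (EuclideanSpace.single i 1) +
      1 / 2 * ((∑ i, ∑ j, h i * h j *
        fderiv ℝ (fderiv ℝ V) x (EuclideanSpace.single i 1) (EuclideanSpace.single j 1)) +
        (lipHess V (Metric.ball x ρ)).toReal * ρ * ∑ i, h i * h i) := by
  rw [← linear_apply_eq_sum, ← bilinear_apply_eq_sum]
  refine sub_le_taylor_two hV x h fun θ hθ => ?_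
  set L := (lipHess V (Metric.ball x ρ)).toReal
  have hL : 0 ≤ L := ENNReal.toReal_nonneg
  have hsq : ∑ i, h i * h i = ‖h‖ ^ 2 := by
    rw [EuclideanSpace.norm_sq_eq]
    simp [sq]
  -- The zero jump is separate because `ρ` may then be zero and the open ball empty.
  rcases eq_or_ne h 0 with rfl | hne
  · simp
  have hpos : 0 < ‖h‖ := norm_pos_iff.2 hne
  have hnorm : ‖θ • h‖ ≤ ‖h‖ := by
    rw [norm_smul, Real.norm_eq_abs, abs_of_pos hθ.1]
    exact mul_le_of_le_one_left hpos.le hθ.2.le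
  -- Strictness comes from `θ < 1`, so the open ball suffices even for a jump of the maximal length
  -- `ρ`.
  have hnorm' : ‖θ • h‖ < ρ := by
    rw [norm_smul, Real.norm_eq_abs, abs_of_pos hθ.1]
    exact (mul_lt_of_lt_one_left hpos hθ.2).trans_le hh
  have hd := norm_sub_le_lipHess hB (y := x + θ • h) (z := x) (by simpa using hnorm')
    (Metric.mem_ball_self (hpos.trans_le hh))
  rw [add_sub_cancel_left] at hd
  have h1 := (le_abs_self _).trans ((fderiv ℝ (fderiv ℝ V) (x + θ • h) -
    fderiv ℝ (fderiv ℝ V) x).le_opNorm₂ h h)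
  simp only [sub_apply] at h1
  have h2 : ‖fderiv ℝ (fderiv ℝ V) (x + θ • h) - fderiv ℝ (fderiv ℝ V) x‖ * ‖h‖ * ‖h‖ ≤
      L * ρ * ‖h‖ ^ 2 := by
    rw [mul_assoc, ← sq]
    refine mul_le_mul_of_nonneg_right (hd.trans ?_) (sq_nonneg _)
    exact mul_le_mul_of_nonneg_left hnorm'.le hL
  rw [hsq]
  linarith

end Euclidean

/-! ### Comparison of the chain generator with the diffusion generator -/

namespace ChainSeq

variable {d : ℕ} {M : ChainSeq d}

theorem toHat_sub_toHat (n : ℕ+) (x y : M.E n) :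
    ((M.toHat n y : EuclideanSpace ℝ (Fin d)) - M.toHat n x) = (√(n : ℝ))⁻¹ • (y.1 - x.1) := by
  simp only [toHat, ← smul_sub, sub_sub_sub_cancel_right]

theorem sqrt_pos (n : ℕ+) : 0 < √(n : ℝ) := Real.sqrt_pos.2 (by exact_mod_cast n.pos)

theorem norm_toHat_sub_le (hM : M.Base) (n : ℕ+) {x y : M.E n} (hxy : 0 < M.q n x y) :
    ‖(M.toHat n y : EuclideanSpace ℝ (Fin d)) - M.toHat n x‖ ≤ M.lbar / √(n : ℝ) := by
  rw [toHat_sub_toHat, norm_smul, norm_inv, Real.norm_of_nonneg (Real.sqrt_nonneg _),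
    inv_mul_eq_div]
  gcongr
  exact le_csSup hM.jumps_bdd ⟨n, x, y, hxy, rfl⟩

theorem xbar_add_toHat (n : ℕ+) (x : M.E n) :
    M.xbar n + √(n : ℝ) • (M.toHat n x : EuclideanSpace ℝ (Fin d)) = x :=
  congrArg Subtype.val (show M.ofHat n (M.toHat n x) = x by
    ext1
    simp [ofHat, toHat, smul_smul, (sqrt_pos n).ne'])

theorem summable_rate_mul (hM : M.Base) (n : ℕ+) (x : M.E n) {g : M.E n → ℝ} {c : ℝ}
    (hg : ∀ y, 0 < M.q n x y → |g y| ≤ c) : Summable fun y => (M.q n x y : ℝ) * g y := by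
  refine Summable.of_norm_bounded
    ((NNReal.summable_coe.2 (hM.rate_summable n x)).mul_right c) fun y => ?_
  rw [norm_mul, Real.norm_eq_abs, Real.norm_eq_abs, NNReal.abs_eq]
  rcases eq_or_lt_of_le (zero_le (a := M.q n x y)) with h | h
  · simp [← h]
  · exact mul_le_mul_of_nonneg_left (hg y h) (NNReal.coe_nonneg _)

theorem abs_jump_le (hM : M.Base) (n : ℕ+) {x y : M.E n} (hxy : 0 < M.q n x y) (i : Fin d) :
    |y.1 i - x.1 i| ≤ M.lbar := by
  have h1 : ‖y.1 - x.1‖ ≤ M.lbar := le_csSup hM.jumps_bdd ⟨n, x, y, hxy, rfl⟩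
  exact (PiLp.norm_apply_le (y.1 - x.1) i).trans h1

/-- Bounded jumps and summable rates make the drift series genuinely convergent; dividing the jumps
by `√n` then matches the scaling of the drift. -/
theorem hasSum_Fhat (hM : M.Base) (n : ℕ+) (x : M.E n) (i : Fin d) :
    HasSum (fun y => (M.q n x y : ℝ) *
      ((M.toHat n y : EuclideanSpace ℝ (Fin d)) - M.toHat n x) i)
      (M.Fhat n (M.toHat n x) i) := by
  have h := (summable_rate_mul hM n x (g := fun y => y.1 i - x.1 i)
    (fun y hy => abs_jump_le hM n hy i)).hasSum.mul_left (√(n : ℝ))⁻¹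
  rw [← hM.F_eq] at h
  convert! h using 1
  · funext y
    rw [toHat_sub_toHat]
    simp
    ring
  · simp [Fhat, xbar_add_toHat]

theorem hasSum_abar (hM : M.Base) (n : ℕ+) (x : M.E n) (i j : Fin d) :
    HasSum (fun y => (M.q n x y : ℝ) *
      (((M.toHat n y : EuclideanSpace ℝ (Fin d)) - M.toHat n x) i *
        ((M.toHat n y : EuclideanSpace ℝ (Fin d)) - M.toHat n x) j))
      (M.abar n (M.toHat n x) i j) := by
  have h := (summable_rate_mul hM n x (g := fun y => (y.1 i - x.1 i) * (y.1 j - x.1 j))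
    (c := M.lbar * M.lbar)
    (fun y hy => by
      have h1 := abs_jump_le hM n hy i
      rw [abs_mul]
      exact mul_le_mul h1 (abs_jump_le hM n hy j) (abs_nonneg _)
        ((abs_nonneg _).trans h1))).hasSum.mul_left ((n : ℝ)⁻¹)
  rw [← hM.a_eq] at h
  convert! h using 1
  · funext y
    have hn : (n : ℝ)⁻¹ = (√(n : ℝ))⁻¹ * (√(n : ℝ))⁻¹ := by
      rw [← mul_inv, Real.mul_self_sqrt (Nat.cast_nonneg _)]
    rw [toHat_sub_toHat, hn]
    simp
    ring
  · simp [abar, xbar_add_toHat]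

/-- The second order expansion of the generator of the scaled chain, with Hessian remainder. -/
theorem tsum_rate_mul_le (hM : M.Base) (n : ℕ+) (x : M.E n) {V : EuclideanSpace ℝ (Fin d) → ℝ}
    (hV : ContDiff ℝ 2 V) (hV0 : ∀ x, 0 ≤ V x)
    (hB : lipHess V (Metric.ball (M.toHat n x : EuclideanSpace ℝ (Fin d))
      (M.lbar / √(n : ℝ))) ≠ ⊤) :
    ∃ T : ℝ, 0 ≤ T ∧
      ∑' y, (M.q n x y : ℝ≥0∞) * ENNReal.ofReal (V (M.toHat n y)) ≤ ENNReal.ofReal T ∧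
      T = exitRate (M.q n) x * V (M.toHat n x) +
        ∑ i, M.Fhat n (M.toHat n x) i *
          fderiv ℝ V (M.toHat n x) (EuclideanSpace.single i 1) +
        1 / 2 * ((∑ i, ∑ j, M.abar n (M.toHat n x) i j *
          fderiv ℝ (fderiv ℝ V) (M.toHat n x) (EuclideanSpace.single i 1)
            (EuclideanSpace.single j 1)) +
          (lipHess V (Metric.ball (M.toHat n x : EuclideanSpace ℝ (Fin d))
            (M.lbar / √(n : ℝ)))).toReal * (M.lbar / √(n : ℝ)) *
            ∑ i, M.abar n (M.toHat n x) i i) := by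
  set ξ : EuclideanSpace ℝ (Fin d) := (M.toHat n x : EuclideanSpace ℝ (Fin d)) with hξ
  set ρ := M.lbar / √(n : ℝ)
  set L := (lipHess V (Metric.ball ξ ρ)).toReal
  set h : M.E n → EuclideanSpace ℝ (Fin d) := fun y => (M.toHat n y).1 - ξ with hh
  set R : M.E n → ℝ := fun y => V ξ + ∑ i, h y i * fderiv ℝ V ξ (EuclideanSpace.single i 1) +
      1 / 2 * ((∑ i, ∑ j, h y i * h y j *
        fderiv ℝ (fderiv ℝ V) ξ (EuclideanSpace.single i 1) (EuclideanSpace.single j 1)) +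
        L * ρ * ∑ i, h y i * h y i) with hR
  -- The Taylor bound is needed only at positive rate, where the jump has length at most `ρ`; at
  -- rate zero both sides vanish.
  have hle : ∀ y, (M.q n x y : ℝ) * V (M.toHat n y) ≤ M.q n x y * R y := by
    intro y
    rcases eq_or_lt_of_le (zero_le (a := M.q n x y)) with h0 | h0
    · simp [← h0]
    · refine mul_le_mul_of_nonneg_left ?_ (NNReal.coe_nonneg _)
      have := taylor_of_norm_le hV ξ (h y) hB (norm_toHat_sub_le hM n h0)
      rwa [show ξ + h y = M.toHat n y by simp [hh]] at this
  have hsum : HasSum (fun y => (M.q n x y : ℝ) * R y) (exitRate (M.q n) x * V ξ +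
        ∑ i, M.Fhat n ξ i * fderiv ℝ V ξ (EuclideanSpace.single i 1) +
        1 / 2 * ((∑ i, ∑ j, M.abar n ξ i j *
          fderiv ℝ (fderiv ℝ V) ξ (EuclideanSpace.single i 1) (EuclideanSpace.single j 1)) +
          L * ρ * ∑ i, M.abar n ξ i i)) := by
    have h0 := (NNReal.summable_coe.2 (hM.rate_summable n x)).hasSum.mul_right (V ξ)
    have h1 := hasSum_sum (s := Finset.univ) fun i _ => (hasSum_Fhat hM n x i).mul_right
      (fderiv ℝ V ξ (EuclideanSpace.single i 1))
    have h2 := hasSum_sum (s := Finset.univ) fun i _ => hasSum_sum (s := Finset.univ) fun j _ =>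
      (hasSum_abar hM n x i j).mul_right
        (fderiv ℝ (fderiv ℝ V) ξ (EuclideanSpace.single i 1) (EuclideanSpace.single j 1))
    have h3 := (hasSum_sum (s := Finset.univ) fun i _ => hasSum_abar hM n x i i).mul_left (L * ρ)
    refine ((h0.add h1).add ((h2.add h3).mul_left (1 / 2))).congr_fun ?_
    intro y
    simp only [hR, mul_assoc, ← Finset.mul_sum]
    ring
  have hnonneg : ∀ y, 0 ≤ (M.q n x y : ℝ) * R y := fun y =>
    (mul_nonneg (NNReal.coe_nonneg _) (hV0 _)).trans (hle y)
  refine ⟨_, hsum.nonneg hnonneg, ?_, rfl⟩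
  calc ∑' y, (M.q n x y : ℝ≥0∞) * ENNReal.ofReal (V (M.toHat n y))
      = ∑' y, ENNReal.ofReal ((M.q n x y : ℝ) * V (M.toHat n y)) := by
        refine tsum_congr fun y => ?_
        rw [ENNReal.ofReal_mul (NNReal.coe_nonneg _), ENNReal.ofReal_coe_nnreal]
    _ ≤ ∑' y, ENNReal.ofReal ((M.q n x y : ℝ) * R y) :=
        ENNReal.tsum_le_tsum fun y => ENNReal.ofReal_le_ofReal (hle y)
    _ = ENNReal.ofReal (∑' y, (M.q n x y : ℝ) * R y) :=
        (ENNReal.ofReal_tsum_of_nonneg hnonneg hsum.summable).symm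
    _ = _ := by rw [hsum.tsum_eq]

/-- The scaled chains inherit the Lyapunov inequality of the diffusion models, with half the
rate, once `n` is large. -/
theorem eventually_drift (hM : M.Base) {V : EuclideanSpace ℝ (Fin d) → ℝ} {b δ K C : ℝ}
    (hV : ContDiff ℝ 2 V) (hV0 : ∀ x, 0 ≤ V x) (hb : 0 < b) (hδ : 0 < δ)
    (hdrift : ∀ n x, M.generator n V x ≤
      -δ * V x + b * (Metric.closedBall (0 : EuclideanSpace ℝ (Fin d)) K).indicator 1 x)
    (hC : 0 < C)
    (hVC : ∀ (n : ℕ+) (x : EuclideanSpace ℝ (Fin d)),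
      (ENNReal.ofReal ‖fderiv ℝ V x‖ + ENNReal.ofReal ‖fderiv ℝ (fderiv ℝ V) x‖ +
        lipHess V (Metric.ball x (M.lbar / √(n : ℝ)))) * ENNReal.ofReal (1 + ‖x‖) ≤
          ENNReal.ofReal (C * V x)) :
    ∀ᶠ n in atTop, ∀ x : M.E n,
      ∑' z, (M.q n x z : ℝ≥0∞) * ENNReal.ofReal (V (M.toHat n z)) +
        ENNReal.ofReal (δ / 2) * ENNReal.ofReal (V (M.toHat n x)) ≤
      ENNReal.ofReal (exitRate (M.q n) x) * ENNReal.ofReal (V (M.toHat n x)) +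
        ENNReal.ofReal b := by
  obtain ⟨A, -, hA⟩ := hM.a_tendsto
  obtain ⟨Ka, hKa⟩ := hM.a_growth
  set τ := |A.trace| + 1
  have hτ : ∀ᶠ n in atTop, (M.abar n 0).trace < τ := by
    have h1 : Tendsto (fun n => (M.abar n 0).trace) atTop (𝓝 A.trace) :=
      (Continuous.matrix_trace continuous_id).tendsto A |>.comp hA
    exact h1.eventually (gt_mem_nhds (by
      have := le_abs_self A.trace
      simp only [τ]; linarith))
  have hl0 : 0 ≤ M.lbar := Real.sSup_nonneg (by
    rintro r ⟨n, x, y, -, rfl⟩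
    exact norm_nonneg _)
  -- The first summand pays for freezing the diffusion matrix at the origin, the second for the
  -- variation of the Hessian over a jump. Both errors grow linearly in the state, and this growth
  -- is absorbed by the factor `1 + ‖x‖` in the bound on the derivatives of `V`.
  set κ := 1 / 2 * (d ^ 2 * |Ka| * C + M.lbar * (τ + d * |Ka|) * C) with hκ
  have hκ0 : 0 ≤ κ := by positivity
  have hlarge : ∀ᶠ n : ℕ+ in atTop, κ / √(n : ℝ) ≤ δ / 2 := by
    have h1 : Tendsto (fun n : ℕ+ => κ / √(n : ℝ)) atTop (𝓝 0) :=
      Tendsto.div_atTop tendsto_const_nhds (Real.tendsto_sqrt_atTop.comp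
        (tendsto_natCast_atTop_atTop.comp tendsto_PNat_val_atTop_atTop))
    exact h1.eventually (ge_mem_nhds (by positivity))
  filter_upwards [hτ, hlarge] with n hτn hn x
  set ξ : EuclideanSpace ℝ (Fin d) := (M.toHat n x : EuclideanSpace ℝ (Fin d)) with hξ
  set r := √(n : ℝ) with hr
  have hr0 : 0 < r := sqrt_pos n
  have hr1 : 1 ≤ r := by
    rw [hr, Real.one_le_sqrt]
    exact_mod_cast n.pos
  set lip := lipHess V (Metric.ball ξ (M.lbar / r))
  set L := lip.toReal
  set D := ‖fderiv ℝ (fderiv ℝ V) ξ‖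
  have hD0 : 0 ≤ D := norm_nonneg (fderiv ℝ (fderiv ℝ V) ξ)
  have h1ξ : 0 < 1 + ‖ξ‖ := by positivity
  have hlip : lip * ENNReal.ofReal (1 + ‖ξ‖) ≤ ENNReal.ofReal (C * V ξ) :=
    le_trans (mul_le_mul_left le_add_self _) (hVC n ξ)
  have hD : D * (1 + ‖ξ‖) ≤ C * V ξ := by
    have := le_trans (mul_le_mul_left (le_add_self.trans le_self_add) _) (hVC n ξ)
    rwa [← ENNReal.ofReal_mul hD0, ENNReal.ofReal_le_ofReal_iff
      (mul_nonneg hC.le (hV0 _))] at this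
  -- The weight `1 + ‖ξ‖` is positive and the bound is finite, so an infinite Lipschitz constant is
  -- impossible.
  have hfin : lip ≠ ⊤ := by
    intro h
    rw [h, ENNReal.top_mul (by simpa using h1ξ)] at hlip
    exact ENNReal.ofReal_ne_top (top_le_iff.1 hlip)
  have hL : L * (1 + ‖ξ‖) ≤ C * V ξ := by
    rw [← ENNReal.ofReal_toReal hfin, ← ENNReal.ofReal_mul ENNReal.toReal_nonneg,
      ENNReal.ofReal_le_ofReal_iff (mul_nonneg hC.le (hV0 _))] at hlip
    exact hlip
  have hL0 : 0 ≤ L := ENNReal.toReal_nonneg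
  have hN : matNorm (M.abar n ξ - M.abar n 0) ≤ |Ka| / r * ‖ξ‖ := (hKa n ξ).trans (by
    gcongr
    exact le_abs_self _)
  have hN' : matNorm (M.abar n ξ - M.abar n 0) ≤ |Ka| * ‖ξ‖ := hN.trans (by
    gcongr
    exact div_le_self (abs_nonneg _) hr1)
  have htr : ∑ i, M.abar n ξ i i ≤ (τ + d * |Ka|) * (1 + ‖ξ‖) := by
    calc ∑ i, M.abar n ξ i i
        = (M.abar n 0).trace + ∑ i, (M.abar n ξ - M.abar n 0) i i := by
          simp [Matrix.trace]
      _ ≤ τ + ∑ _i : Fin d, |Ka| * ‖ξ‖ := by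
          gcongr with i
          exact (le_abs_self _).trans ((abs_le_matNorm _ i i).trans hN')
      _ ≤ _ := by
          simp only [Finset.sum_const, Finset.card_univ, Fintype.card_fin, nsmul_eq_mul]
          have : 0 ≤ τ * ‖ξ‖ := by positivity
          have : 0 ≤ d * |Ka| := by positivity
          nlinarith
  have hHess : ∑ i, ∑ j, M.abar n ξ i j * fderiv ℝ (fderiv ℝ V) ξ (EuclideanSpace.single i 1)
        (EuclideanSpace.single j 1) ≤
      (∑ i, ∑ j, M.abar n 0 i j * fderiv ℝ (fderiv ℝ V) ξ (EuclideanSpace.single i 1)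
        (EuclideanSpace.single j 1)) + d ^ 2 * |Ka| * C * V ξ / r := by
    have h1 := sum_mul_bilinear_le (M.abar n ξ - M.abar n 0) (fderiv ℝ (fderiv ℝ V) ξ)
    simp only [Matrix.sub_apply, sub_mul, Finset.sum_sub_distrib] at h1
    have h2 : (d : ℝ) ^ 2 * (matNorm (M.abar n ξ - M.abar n 0) * D) ≤
        d ^ 2 * |Ka| * C * V ξ / r := by
      calc (d : ℝ) ^ 2 * (matNorm (M.abar n ξ - M.abar n 0) * D)
          ≤ d ^ 2 * ((|Ka| / r * ‖ξ‖) * D) := by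
            gcongr
        _ = d ^ 2 * (|Ka| / r) * (D * ‖ξ‖) := by ring
        _ ≤ d ^ 2 * (|Ka| / r) * (C * V ξ) := by
            refine mul_le_mul_of_nonneg_left (le_trans ?_ hD) (by positivity)
            exact mul_le_mul_of_nonneg_left (by linarith) hD0
        _ = _ := by ring
    linarith
  have hrem : L * (M.lbar / r) * ∑ i, M.abar n ξ i i ≤
      M.lbar * (τ + d * |Ka|) * C * V ξ / r := by
    calc L * (M.lbar / r) * ∑ i, M.abar n ξ i i
        ≤ L * (M.lbar / r) * ((τ + d * |Ka|) * (1 + ‖ξ‖)) := by gcongr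
      _ = (M.lbar / r) * (τ + d * |Ka|) * (L * (1 + ‖ξ‖)) := by ring
      _ ≤ (M.lbar / r) * (τ + d * |Ka|) * (C * V ξ) := by gcongr
      _ = _ := by ring
  have hgen := hdrift n ξ
  rw [generator] at hgen
  have hind : b * (Metric.closedBall (0 : EuclideanSpace ℝ (Fin d)) K).indicator 1 ξ ≤ b := by
    refine mul_le_of_le_one_right hb.le ?_
    exact Set.indicator_le_self' (fun _ _ => zero_le_one) ξ
  -- Half of the decay `δ * V` absorbs the errors; the other half is the term on the left of the
  -- goal.
  have hκV : κ / r * V ξ ≤ δ / 2 * V ξ := mul_le_mul_of_nonneg_right hn (hV0 _)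
  have hκeq : κ / r * V ξ = 1 / 2 * (d ^ 2 * |Ka| * C * V ξ / r +
      M.lbar * (τ + d * |Ka|) * C * V ξ / r) := by
    rw [hκ]
    ring
  have hQ := exitRate_nonneg (M.q n) x
  obtain ⟨T, hT0, hT, hTeq⟩ := tsum_rate_mul_le hM n x hV hV0 hfin
  refine (add_le_add_left hT _).trans ?_
  rw [← ENNReal.ofReal_mul (by positivity), ← ENNReal.ofReal_mul hQ,
    ← ENNReal.ofReal_add (mul_nonneg hQ (hV0 _)) hb.le,
    ← ENNReal.ofReal_add hT0 (mul_nonneg (by positivity) (hV0 _))]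
  refine ENNReal.ofReal_le_ofReal ?_
  linarith

end ChainSeq

/-! ### From transition functions to expectations over paths -/

namespace IsCTMC

variable {S : Type*} {Ω : Type*} [MeasurableSpace Ω] [MeasurableSpace S]
  {q : S → S → ℝ≥0} {P : S → Measure Ω} {X : ℝ → Ω → S}

theorem measure_eq_transProb (h : IsCTMC q P X) {t : ℝ} (ht : 0 ≤ t) (x y : S) :
    P x {ω | X t ω = y} = transProb q t x y := by
  have := h.fdd x 0 (fun _ => t) (fun _ => y) ht monotone_const
  simpa using this

theorem measure_inter_eq (h : IsCTMC q P X) {s t : ℝ} (hs : 0 ≤ s) (ht : 0 ≤ t) (x y z : S) :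
    P x {ω | X s ω = y ∧ X (s + t) ω = z} = transProb q s x y * transProb q t y z := by
  have := h.fdd x 1 ![s, s + t] ![y, z] hs (by
    intro i j hij
    fin_cases i <;> fin_cases j <;> simp_all)
  simpa [Fin.forall_fin_two] using this

variable [Countable S] [MeasurableSingletonClass S]

theorem lintegral_eq_tsum (h : IsCTMC q P X) {t : ℝ} (ht : 0 ≤ t) (x : S) (g : S → ℝ≥0∞) :
    ∫⁻ ω, g (X t ω) ∂P x = ∑' y, transProb q t x y * g y := by
  rw [← lintegral_map (measurable_of_countable g) (h.measurable t ht), lintegral_countable']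
  refine tsum_congr fun y => ?_
  rw [Measure.map_apply (h.measurable t ht) (measurableSet_singleton y), mul_comm]
  exact congrArg (· * g y) (h.measure_eq_transProb ht x y)

/-- The transition function of an irreducible chain is an irreducible Markov semigroup. -/
theorem isMarkovSemigroup (h : IsCTMC q P X) (hq : IrreducibleRates q) :
    IsMarkovSemigroup (transProb q) where
  tsum_eq_one t ht x := by
    have := h.prob x
    have := h.lintegral_eq_tsum ht x fun _ => 1
    simpa using this.symm
  comp s t hs ht x z := by
    rw [← h.measure_eq_transProb (add_nonneg hs ht)]
    have hset : {ω | X (s + t) ω = z} = ⋃ y, {ω | X s ω = y ∧ X (s + t) ω = z} := by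
      ext ω
      simp
    rw [hset, measure_iUnion]
    · simp_rw [h.measure_inter_eq hs ht]
    · intro y y' hne
      rw [Function.onFun, Set.disjoint_left]
      rintro ω ⟨h1, -⟩ ⟨h2, -⟩
      exact hne (h1.symm.trans h2)
    · intro y
      exact (h.measurable s hs (measurableSet_singleton y)).inter
        (h.measurable _ (add_nonneg hs ht) (measurableSet_singleton z))
  pos t ht x y := transProb_pos q (hq x y) ht

/-- Right-continuous paths make functions of the chain jointly measurable. -/
theorem measurable_indicator_uncurry (h : IsCTMC q P X) (g : S → ℝ) :
    Measurable ({p : Ω × ℝ | 0 ≤ p.2}.indicator fun p => g (X p.2 p.1)) := by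
  have hset : MeasurableSet {p : Ω × ℝ | 0 ≤ p.2} := measurableSet_le measurable_const measurable_snd
  -- Time is rounded up to a grid of mesh `1 / (m + 1)`. The `k + 1` makes the grid point strictly
  -- later than the given time, as right-continuity along `𝓝[>]` requires.
  let τ : ℕ → ℕ → ℝ := fun m k => ((k : ℝ) + 1) / ((m : ℝ) + 1)
  have hτ : ∀ m k, 0 ≤ τ m k := fun m k => by positivity
  let G : ℕ → Ω × ℝ → ℝ := fun m => {p : Ω × ℝ | 0 ≤ p.2}.indicator fun p =>
    g (X (τ m ⌊p.2 * ((m : ℝ) + 1)⌋₊) p.1)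
  have hG : ∀ m, Measurable (G m) := by
    intro m
    have h1 : Measurable fun p : Ω × ℕ => g (X (τ m p.2) p.1) :=
      measurable_from_prod_countable_left fun k =>
        (measurable_of_countable g).comp (h.measurable _ (hτ m k))
    refine Measurable.indicator ?_ hset
    exact h1.comp (measurable_fst.prodMk (Nat.measurable_floor.comp
      (measurable_snd.mul_const _)))
  refine measurable_of_tendsto_metrizable hG (tendsto_pi_nhds.2 fun p => ?_)
  by_cases hp : 0 ≤ p.2
  · have hmem : p ∈ {p : Ω × ℝ | 0 ≤ p.2} := hp
    simp only [G, Set.indicator_of_mem hmem]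
    have hm : ∀ m : ℕ, (0 : ℝ) < (m : ℝ) + 1 := fun m => by positivity
    have hgt : ∀ m : ℕ, p.2 < τ m ⌊p.2 * ((m : ℝ) + 1)⌋₊ := fun m => by
      rw [lt_div_iff₀ (hm m)]
      exact Nat.lt_floor_add_one _
    have hle : ∀ m : ℕ, τ m ⌊p.2 * ((m : ℝ) + 1)⌋₊ ≤ p.2 + 1 / ((m : ℝ) + 1) := fun m => by
      rw [div_le_iff₀ (hm m), add_mul, one_div_mul_cancel (hm m).ne']
      gcongr
      exact Nat.floor_le (mul_nonneg hp (hm m).le)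
    have hlim : Tendsto (fun m : ℕ => τ m ⌊p.2 * ((m : ℝ) + 1)⌋₊) atTop (𝓝[>] p.2) := by
      refine tendsto_nhdsWithin_iff.2 ⟨?_, Eventually.of_forall hgt⟩
      refine tendsto_of_tendsto_of_tendsto_of_le_of_le tendsto_const_nhds ?_
        (fun m => (hgt m).le) hle
      simpa using tendsto_const_nhds.add (tendsto_one_div_add_atTop_nhds_zero_nat (𝕜 := ℝ))
    refine tendsto_const_nhds.congr' ?_
    filter_upwards [hlim.eventually (h.rightCont p.1 p.2 hp)] with m hm'
    rw [hm']
  · have hmem : p ∉ {p : Ω × ℝ | 0 ≤ p.2} := hp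
    simp only [G, Set.indicator_of_notMem hmem]
    exact tendsto_const_nhds

theorem aestronglyMeasurable_uncurry (h : IsCTMC q P X) (g : S → ℝ) (x : S) (t : ℝ) :
    AEStronglyMeasurable (fun p : Ω × ℝ => g (X p.2 p.1))
      ((P x).prod (volume.restrict (Set.Ioc 0 t))) := by
  have := h.prob x
  refine (h.measurable_indicator_uncurry g).aestronglyMeasurable.congr ?_
  have h1 : ∀ᵐ p : Ω × ℝ ∂(P x).prod (volume.restrict (Set.Ioc 0 t)), p.2 ∈ Set.Ioc 0 t :=
    Measure.quasiMeasurePreserving_snd.ae (ae_restrict_mem measurableSet_Ioc)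
  filter_upwards [h1] with p hp
  exact Set.indicator_of_mem (show p ∈ {p : Ω × ℝ | 0 ≤ p.2} from hp.1.le) _

/-- Tonelli, with time as the outer variable; it applies because right-continuous paths make the
integrand jointly measurable. -/
theorem lintegral_prod_eq (h : IsCTMC q P X) {g : S → ℝ} (x : S) (t : ℝ) :
    ∫⁻ p, ENNReal.ofReal (g (X p.2 p.1)) ∂(P x).prod (volume.restrict (Set.Ioc 0 t)) =
      ∫⁻ s in Set.Icc 0 t, ∑' y, transProb q s x y * ENNReal.ofReal (g y) := by
  have := h.prob x
  rw [lintegral_prod_symm _ (h.aestronglyMeasurable_uncurry g x t).aemeasurable.ennreal_ofReal,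
    setLIntegral_congr Ioc_ae_eq_Icc.symm]
  refine setLIntegral_congr_fun measurableSet_Ioc fun s hs => ?_
  exact h.lintegral_eq_tsum hs.1.le x fun y => ENNReal.ofReal (g y)

/-- The Foster-Lyapunov inequality in expectation. -/
theorem integral_le_of_drift (h : IsCTMC q P X) {g : S → ℝ} (hg : ∀ y, 0 ≤ g y) {b c : ℝ}
    (hb : 0 ≤ b) (hc : 0 < c) (hq : ∀ x, Summable (q x))
    (hdrift : ∀ x, ∑' z, (q x z : ℝ≥0∞) * ENNReal.ofReal (g z) +
      ENNReal.ofReal c * ENNReal.ofReal (g x) ≤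
        ENNReal.ofReal (exitRate q x) * ENNReal.ofReal (g x) + ENNReal.ofReal b)
    (x : S) {t : ℝ} (ht : 0 ≤ t) :
    Integrable (fun ω => g (X t ω)) (P x) ∧
      Integrable (fun p : Ω × ℝ => g (X p.2 p.1))
        ((P x).prod (volume.restrict (Set.Ioc 0 t))) ∧
      ∫ ω, g (X t ω) ∂P x ≤
        g x + ∫ ω, (∫ s in (0 : ℝ)..t, (-c * g (X s ω) + b)) ∂P x := by
  have := h.prob x
  have hmain := tsum_transProb_mul_add_le q hq hdrift x ht
  rw [← h.lintegral_eq_tsum ht x (fun y => ENNReal.ofReal (g y)), ← h.lintegral_prod_eq,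
    ← ENNReal.ofReal_mul hb, ← ENNReal.ofReal_add (hg x) (mul_nonneg hb ht)] at hmain
  set I := ∫⁻ ω, ENNReal.ofReal (g (X t ω)) ∂P x with hI
  set J := ∫⁻ p, ENNReal.ofReal (g (X p.2 p.1)) ∂(P x).prod (volume.restrict (Set.Ioc 0 t)) with hJ
  have hIfin : I ≠ ⊤ := ne_top_of_le_ne_top ENNReal.ofReal_ne_top (le_self_add.trans hmain)
  -- Since `c` is positive, an infinite time integral would violate the finite bound.
  have hJfin : J ≠ ⊤ := by
    intro htop
    rw [htop, ENNReal.mul_top (by simpa using hc)] at hmain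
    simp at hmain
  have hm1 : AEStronglyMeasurable (fun ω => g (X t ω)) (P x) :=
    ((measurable_of_countable g).comp (h.measurable t ht)).aestronglyMeasurable
  have hm2 := h.aestronglyMeasurable_uncurry g x t
  have hint1 : Integrable (fun ω => g (X t ω)) (P x) :=
    (lintegral_ofReal_ne_top_iff_integrable hm1 (Eventually.of_forall fun _ => hg _)).1 hIfin
  have hint2 := (lintegral_ofReal_ne_top_iff_integrable hm2
    (Eventually.of_forall fun _ => hg _)).1 hJfin
  refine ⟨hint1, hint2, ?_⟩
  have hreal : ∫ ω, g (X t ω) ∂P x +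
      c * ∫ p, g (X p.2 p.1) ∂(P x).prod (volume.restrict (Set.Ioc 0 t)) ≤ g x + b * t := by
    rw [integral_eq_lintegral_of_nonneg_ae (Eventually.of_forall fun _ => hg _) hm1,
      integral_eq_lintegral_of_nonneg_ae (Eventually.of_forall fun _ => hg _) hm2]
    have := ENNReal.toReal_mono ENNReal.ofReal_ne_top hmain
    rwa [ENNReal.toReal_add hIfin (ENNReal.mul_ne_top ENNReal.ofReal_ne_top hJfin),
      ENNReal.toReal_mul, ENNReal.toReal_ofReal hc.le,
      ENNReal.toReal_ofReal (add_nonneg (hg x) (mul_nonneg hb ht))] at this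
  have hint3 : Integrable (fun p : Ω × ℝ => -c * g (X p.2 p.1) + b)
      ((P x).prod (volume.restrict (Set.Ioc 0 t))) :=
    (hint2.const_mul (-c)).add (integrable_const b)
  simp_rw [intervalIntegral.integral_of_le ht]
  rw [← integral_prod _ hint3, integral_add (hint2.const_mul (-c)) (integrable_const b),
    integral_const_mul]
  have hvol : ((P x).prod (volume.restrict (Set.Ioc 0 t))).real Set.univ = t := by
    rw [measureReal_def, ← Set.univ_prod_univ, Measure.prod_prod]
    simp [ht]
  rw [integral_const, hvol, smul_eq_mul]
  linarith

end IsCTMC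

/-! ### Stationary and steady-state distributions of the process -/

section Ergodicity

variable {S : Type*} [MeasurableSpace S] {Ω : Type*} [MeasurableSpace Ω]

/-- `ξ` has the one-dimensional laws given by the semigroup `p`. -/
structure HasTransition (p : ℝ → S → S → ℝ≥0∞) (P : S → Measure Ω) (ξ : ℝ → Ω → S) : Prop where
  prob : ∀ x, IsProbabilityMeasure (P x)
  measurable : ∀ t, 0 ≤ t → Measurable (ξ t)
  start : ∀ x, ∀ᵐ ω ∂P x, ξ 0 ω = x
  law : ∀ t, 0 ≤ t → ∀ x y, (P x).map (ξ t) {y} = p t x y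

namespace HasTransition

variable {p : ℝ → S → S → ℝ≥0∞} {P : S → Measure Ω} {ξ : ℝ → Ω → S}

theorem integral_zero (h : HasTransition p P ξ) (x : S) (f : S → ℝ) :
    ∫ ω, f (ξ 0 ω) ∂P x = f x := by
  have := h.prob x
  rw [integral_congr_ae (g := fun _ => f x) ((h.start x).mono fun ω hω => by simp [hω])]
  simp

variable [Countable S] [MeasurableSingletonClass S]

theorem lintegral_eq_tsum (h : HasTransition p P ξ) {t : ℝ} (ht : 0 ≤ t) (x : S) (g : S → ℝ≥0∞) :
    ∫⁻ ω, g (ξ t ω) ∂P x = ∑' y, p t x y * g y := by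
  rw [← lintegral_map (measurable_of_countable g) (h.measurable t ht), lintegral_countable']
  exact tsum_congr fun y => by rw [h.law t ht, mul_comm]

theorem integral_map_eq (h : HasTransition p P ξ) {t : ℝ} (ht : 0 ≤ t) (x : S) (f : S → ℝ) :
    ∫ y, f y ∂(P x).map (ξ t) = ∫ ω, f (ξ t ω) ∂P x :=
  integral_map (h.measurable t ht).aemeasurable
    (measurable_of_countable f).aestronglyMeasurable

/-- The law at time `t` when the initial state has law `ν`. -/
theorem bind_singleton (h : HasTransition p P ξ) (ν : Measure S) {t : ℝ} (ht : 0 ≤ t) (y : S) :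
    ν.bind (fun x => (P x).map (ξ t)) {y} = ∑' x, ν {x} * p t x y := by
  rw [Measure.bind_apply (measurableSet_singleton y) (measurable_of_countable _).aemeasurable,
    lintegral_countable']
  exact tsum_congr fun x => by rw [h.law t ht, mul_comm]

/-- The Markov kernel of the process at time `t`. -/
noncomputable def kernel (_h : HasTransition p P ξ) (t : ℝ) : ProbabilityTheory.Kernel S S :=
  ⟨fun x => (P x).map (ξ t), measurable_of_countable _⟩

theorem isMarkovKernel (h : HasTransition p P ξ) {t : ℝ} (ht : 0 ≤ t) :
    ProbabilityTheory.IsMarkovKernel (h.kernel t) :=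
  ⟨fun x => by
    have := h.prob x
    exact Measure.isProbabilityMeasure_map (h.measurable t ht).aemeasurable⟩

theorem isProbabilityMeasure_bind (h : HasTransition p P ξ) (ν : Measure S)
    [IsProbabilityMeasure ν] {t : ℝ} (ht : 0 ≤ t) :
    IsProbabilityMeasure (ν.bind (fun x => (P x).map (ξ t))) := by
  have := h.isMarkovKernel ht
  exact inferInstanceAs (IsProbabilityMeasure (ν.bind (h.kernel t)))

theorem integral_bind (h : HasTransition p P ξ) (ν : Measure S) [IsProbabilityMeasure ν] {t : ℝ}
    (ht : 0 ≤ t) {f : S → ℝ} {B : ℝ} (hf : ∀ y, |f y| ≤ B) :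
    ∫ y, f y ∂ν.bind (fun x => (P x).map (ξ t)) = ∫ x, (∫ ω, f (ξ t ω) ∂P x) ∂ν := by
  have := h.isProbabilityMeasure_bind ν ht
  have hint : Integrable f (ν.bind (fun x => (P x).map (ξ t))) := Integrable.of_bound
    (measurable_of_countable f).aestronglyMeasurable B (Eventually.of_forall hf)
  have := ProbabilityTheory.Kernel.integral_comp (η := h.kernel t)
    (κ := ProbabilityTheory.Kernel.const Unit ν) (a := ()) (f := f) hint
  refine Eq.trans this (integral_congr_ae (Eventually.of_forall fun x => ?_))
  exact h.integral_map_eq ht x f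

theorem _root_.MeasureTheory.tsum_measure_singleton {α : Type*} [Countable α] [MeasurableSpace α]
    [MeasurableSingletonClass α] (ν : Measure α) : ∑' y, ν {y} = ν Set.univ := by
  have := lintegral_countable' (μ := ν) fun _ => 1
  simpa using this.symm

variable [TopologicalSpace S]

/-- Stationarity is tested only on bounded continuous functions, and the topology need not be
discrete. Such functions still determine finite Borel measures under `HasOuterApproxClosed`, so the
law at time `t` equals `ν` and can be read off at single points. -/
theorem isInvariantProb_of_isStationaryDist [BorelSpace S] [HasOuterApproxClosed S]
    (h : HasTransition p P ξ) {ν : Measure S} (hν : IsStationaryDist P ξ ν) :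
    IsInvariantProb p fun y => ν {y} := by
  have := hν.1
  refine ⟨by rw [tsum_measure_singleton, measure_univ], fun t ht y => ?_⟩
  have := h.isProbabilityMeasure_bind ν ht
  have heq : ν.bind (fun x => (P x).map (ξ t)) = ν := by
    refine ext_of_forall_integral_eq_of_IsFiniteMeasure fun f => ?_
    rw [h.integral_bind ν ht fun y => f.norm_coe_le_norm y, hν.2 f t ht]
    simp_rw [h.integral_zero]
  rw [← h.bind_singleton ν ht y, heq]

/-- Irreducible processes with an invariant law are ergodic. -/
theorem isErgodic (h : HasTransition p P ξ) (hp : IsMarkovSemigroup p) {π : S → ℝ≥0∞}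
    (hπ : IsInvariantProb p π) : IsErgodic P ξ := by
  set ν : Measure S := Measure.sum fun y => π y • Measure.dirac y with hνdef
  have hν : ∀ y, ν {y} = π y := by
    intro y
    rw [hνdef, Measure.sum_apply _ (measurableSet_singleton y), tsum_eq_single y]
    · simp
    · intro z hz
      simp [hz]
  have hprob : IsProbabilityMeasure ν := ⟨by
    rw [← tsum_measure_singleton]
    simp_rw [hν]
    exact hπ.tsum_eq_one⟩
  refine ⟨ν, ⟨hprob, fun f t ht => ?_⟩, fun f ⟨B, hB⟩ x => ?_⟩
  · have heq : ν.bind (fun x => (P x).map (ξ t)) = ν := Measure.ext_of_singleton fun y => by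
      rw [h.bind_singleton ν ht y]
      simp_rw [hν]
      exact hπ.invariant t ht y
    rw [← h.integral_bind ν ht fun y => f.norm_coe_le_norm y, heq]
    simp_rw [h.integral_zero]
  · have hB0 : 0 ≤ B := (abs_nonneg _).trans (hB x)
    rw [Metric.tendsto_nhds]
    intro ε hε
    have hε' : 0 < ε / (2 * B + 1) := by positivity
    filter_upwards [hp.eventually_one_le_overlap_add hπ x
      (ENNReal.ofReal_pos.2 hε').ne', eventually_ge_atTop 0] with t hov ht
    have hPx := h.prob x
    have := Measure.isProbabilityMeasure_map (μ := P x) (h.measurable t ht).aemeasurable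
    rw [← h.integral_map_eq ht, Real.dist_eq]
    refine (abs_integral_sub_integral_le_of_overlap _ ν hε'.le ?_ hB hB0).trans_lt ?_
    · simp_rw [h.law t ht, hν]
      exact hov
    · rw [mul_div_assoc', div_lt_iff₀ (by positivity)]
      nlinarith

/-- A linear bound on the integrated expectation of a nonnegative continuous function bounds its
mean under the steady-state law. -/
theorem lintegral_le_of_isSteadyStateDist [OpensMeasurableSpace S] (h : HasTransition p P ξ)
    {ν : Measure S} (hν : IsSteadyStateDist P ξ ν) (x : S) {g : S → ℝ} (hg : Continuous g)
    (hg0 : ∀ y, 0 ≤ g y) {A B : ℝ} (hB0 : 0 ≤ B)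
    (hAB : ∀ T, 0 ≤ T → ∫⁻ s in Set.Icc (0 : ℝ) T, ∑' y, p s x y * ENNReal.ofReal (g y) ≤
      ENNReal.ofReal (A + B * T)) :
    ∫⁻ y, ENNReal.ofReal (g y) ∂ν ≤ ENNReal.ofReal B := by
  have hνp := hν.1
  have hPx := h.prob x
  -- Convergence to `ν` is known only for bounded functions, so `g` is truncated and recovered by
  -- monotone convergence.
  have hmin : ∀ R : ℕ, ∫⁻ y, ENNReal.ofReal (min (g y) R) ∂ν ≤ ENNReal.ofReal B := by
    intro R
    have hR0 : ∀ y, 0 ≤ min (g y) R := fun y => le_min (hg0 y) (Nat.cast_nonneg R)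
    have hbd : ∀ y, ‖min (g y) R‖ ≤ R := fun y => by
      rw [Real.norm_of_nonneg (hR0 y)]
      exact min_le_right _ _
    set f : S →ᵇ ℝ := BoundedContinuousFunction.ofNormedAddCommGroup (fun y => min (g y) R)
      (hg.min continuous_const) R hbd with hf
    have hlim := hν.2 f x
    have hint : ∀ κ : Measure S, IsProbabilityMeasure κ → Integrable f κ := fun κ _ =>
      Integrable.of_bound (measurable_of_countable f).aestronglyMeasurable R
        (Eventually.of_forall hbd)
    have hLB : ∫ y, f y ∂ν ≤ B := by
      by_contra! hlt
      -- If the truncated mean exceeded `B`, expectations would stay above some `L > B` from a time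
      -- `T₁` on, and the integral would eventually outgrow its linear bound of slope `B`.
      obtain ⟨L, hBL, hL⟩ := exists_between hlt
      obtain ⟨T₀, hT₀⟩ := eventually_atTop.1 (hlim.eventually (lt_mem_nhds hL))
      set T₁ := max T₀ 0
      have hT₁ : 0 ≤ T₁ := le_max_right _ _
      have hlow : ∀ s, T₁ ≤ s → ENNReal.ofReal L ≤ ∑' y, p s x y * ENNReal.ofReal (g y) := by
        intro s hs
        have hs0 := hT₁.trans hs
        have hLs := hT₀ s ((le_max_left _ _).trans hs)
        rw [← h.lintegral_eq_tsum hs0 x fun y => ENNReal.ofReal (g y)]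
        have hi : Integrable (fun ω => f (ξ s ω)) (P x) := Integrable.of_bound
          ((measurable_of_countable f).comp (h.measurable s hs0)).aestronglyMeasurable R
          (Eventually.of_forall fun ω => hbd _)
        refine (ENNReal.ofReal_le_ofReal hLs.le).trans ?_
        rw [ofReal_integral_eq_lintegral_ofReal hi (Eventually.of_forall fun ω => hR0 _)]
        exact lintegral_mono fun ω => ENNReal.ofReal_le_ofReal (min_le_left _ _)
      have hlin : ∀ T, T₁ ≤ T → L * (T - T₁) ≤ max A 0 + B * T := by
        intro T hT
        have hT0 := hT₁.trans hT
        rw [← ENNReal.ofReal_le_ofReal_iff (by positivity)]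
        calc ENNReal.ofReal (L * (T - T₁))
            = ∫⁻ s in Set.Icc T₁ T, ENNReal.ofReal L := by
              rw [ENNReal.ofReal_mul (hB0.trans hBL.le)]
              simp
          _ ≤ ∫⁻ s in Set.Icc T₁ T, ∑' y, p s x y * ENNReal.ofReal (g y) :=
              setLIntegral_mono' measurableSet_Icc fun s hs => hlow s hs.1
          _ ≤ ∫⁻ s in Set.Icc 0 T, ∑' y, p s x y * ENNReal.ofReal (g y) :=
              lintegral_mono_set (Set.Icc_subset_Icc_left hT₁)
          _ ≤ ENNReal.ofReal (A + B * T) := hAB T hT0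
          _ ≤ _ := ENNReal.ofReal_le_ofReal (by gcongr; exact le_max_left _ _)
      have hLB0 : 0 < L - B := sub_pos.2 hBL
      -- Chosen so that by time `D` the excess slope `L - B` has outrun all the constants by one.
      set D := (max A 0 + L * T₁ + 1) / (L - B)
      have hD : (L - B) * D = max A 0 + L * T₁ + 1 := mul_div_cancel₀ _ hLB0.ne'
      have h1 := hlin (max D T₁) (le_max_right _ _)
      have h2 : (L - B) * D ≤ (L - B) * max D T₁ :=
        mul_le_mul_of_nonneg_left (le_max_left _ _) hLB0.le
      linarith
    calc ∫⁻ y, ENNReal.ofReal (min (g y) R) ∂ν = ENNReal.ofReal (∫ y, f y ∂ν) :=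
          (ofReal_integral_eq_lintegral_ofReal (hint ν hνp) (Eventually.of_forall hR0)).symm
      _ ≤ _ := ENNReal.ofReal_le_ofReal hLB
  have hsup : ∀ y, ENNReal.ofReal (g y) = ⨆ R : ℕ, ENNReal.ofReal (min (g y) R) := by
    intro y
    refine le_antisymm ?_ (iSup_le fun R => ENNReal.ofReal_le_ofReal (min_le_left _ _))
    obtain ⟨R, hR⟩ := exists_nat_ge (g y)
    refine le_iSup_of_le R ?_
    rw [min_eq_left hR]
  simp_rw [hsup]
  rw [lintegral_iSup (fun R => measurable_of_countable _)]
  · exact iSup_le hmin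
  · intro i j hij y
    exact ENNReal.ofReal_le_ofReal (min_le_min_left _ (Nat.cast_le.2 hij))

end HasTransition

end Ergodicity

/-! ### Transfer to the scaled state space -/

theorem IsMarkovSemigroup.comap_equiv {S S' : Type*} {p : ℝ → S → S → ℝ≥0∞}
    (hp : IsMarkovSemigroup p) (e : S' ≃ S) :
    IsMarkovSemigroup fun t x y => p t (e x) (e y) where
  tsum_eq_one t ht x := (e.tsum_eq fun y => p t (e x) y).trans (hp.tsum_eq_one t ht _)
  comp s t hs ht x z := (hp.comp s t hs ht _ _).trans
    (e.tsum_eq fun y => p s (e x) y * p t y (e z)).symm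
  pos t ht _ _ := hp.pos t ht _ _

namespace ChainSeq

variable {d : ℕ} {M : ChainSeq d}

theorem toHat_ofHat (n : ℕ+) (x : M.Ehat n) : M.toHat n (M.ofHat n x) = x := by
  ext1
  simp [ofHat, toHat, smul_smul, (sqrt_pos n).ne']

theorem ofHat_toHat (n : ℕ+) (x : M.E n) : M.ofHat n (M.toHat n x) = x := by
  ext1
  simp [ofHat, toHat, smul_smul, (sqrt_pos n).ne']

/-- The scaled and the original state space are in bijection. -/
noncomputable def hatEquiv (M : ChainSeq d) (n : ℕ+) : M.Ehat n ≃ M.E n where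
  toFun := M.ofHat n
  invFun := M.toHat n
  left_inv := toHat_ofHat n
  right_inv := ofHat_toHat n

theorem hasTransition {Ω : Type*} [MeasurableSpace Ω] (n : ℕ+) [Countable (M.E n)]
    {P : M.E n → Measure Ω} {X : ℝ → Ω → M.E n} (hX : IsCTMC (M.q n) P X) :
    HasTransition (fun t x y => transProb (M.q n) t (M.hatEquiv n x) (M.hatEquiv n y))
      (fun x => P (M.ofHat n x)) (fun t ω => M.toHat n (X t ω)) where
  prob x := hX.prob _
  measurable t ht := (measurable_of_countable (M.toHat n)).comp (hX.measurable t ht)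
  start x := (hX.start _).mono fun ω hω => by rw [hω, toHat_ofHat]
  law t ht x y := by
    have hm : Measurable fun ω => M.toHat n (X t ω) :=
      (measurable_of_countable (M.toHat n)).comp (hX.measurable t ht)
    rw [Measure.map_apply hm (measurableSet_singleton y)]
    refine Eq.trans (congrArg _ ?_) (hX.measure_eq_transProb ht _ _)
    ext ω
    exact (M.hatEquiv n).symm_apply_eq

/-- Growth of `V` confines the sublevel set to a ball, and undoing the scaling gives a bounded piece
of the original state space. -/
theorem finite_sublevel {V : EuclideanSpace ℝ (Fin d) → ℝ} (hV : NormLike V) (n : ℕ+)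
    (hE : ∀ r : ℝ, (M.E n ∩ Metric.closedBall 0 r).Finite) (R : ℝ≥0) :
    {y : M.Ehat n | ENNReal.ofReal (V y) ≤ R}.Finite := by
  obtain ⟨r, hr⟩ := eventually_atTop.1
    (eventually_comap.1 (hV.eventually (eventually_gt_atTop (R : ℝ))))
  refine ((hE (‖M.xbar n‖ + √(n : ℝ) * r)).preimage (f := fun y : M.Ehat n =>
    (M.ofHat n y : EuclideanSpace ℝ (Fin d)))
    ((Subtype.val_injective.comp (M.hatEquiv n).injective).injOn)).subset ?_
  intro y hy
  have hy' : V y ≤ R := by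
    rw [Set.mem_ofPred_eq, ← ENNReal.ofReal_coe_nnreal,
      ENNReal.ofReal_le_ofReal_iff R.coe_nonneg] at hy
    exact hy
  have hyr : ‖(y : EuclideanSpace ℝ (Fin d))‖ ≤ r := by
    by_contra! h
    exact absurd (hr _ h.le y rfl) (not_lt.2 hy')
  refine ⟨(M.ofHat n y).2, ?_⟩
  rw [mem_closedBall_zero_iff]
  refine (norm_add_le _ _).trans ?_
  rw [norm_smul, Real.norm_of_nonneg (Real.sqrt_nonneg _)]
  gcongr

end ChainSeq

theorem le_ofReal_div_of_ofReal_mul_le {J : ℝ≥0∞} {c r : ℝ} (hc : 0 < c)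
    (h : ENNReal.ofReal c * J ≤ ENNReal.ofReal r) : J ≤ ENNReal.ofReal (r / c) := by
  rw [ENNReal.ofReal_div_of_pos hc, ENNReal.le_div_iff_mul_le
    (Or.inl (ENNReal.ofReal_pos.2 hc).ne') (Or.inl ENNReal.ofReal_ne_top), mul_comm]
  exact h

/-! ### Assembly of the three conclusions -/

theorem theorem3p3 {d : ℕ} (M : ChainSeq d) (hM : M.Base)
    {Ω : ℕ+ → Type*} [∀ n, MeasurableSpace (Ω n)]
    (P : ∀ n, M.E n → Measure (Ω n)) (X : ∀ n, ℝ → Ω n → M.E n)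
    (hX : ∀ n, IsCTMC (M.q n) (P n) (X n))
    (V : EuclideanSpace ℝ (Fin d) → ℝ) (b δ K : ℝ) (hV : UniformLyapunov M P X V b δ K)
    (C : ℝ) (hC : 0 < C)
    (hVC : ∀ (n : ℕ+) (x : EuclideanSpace ℝ (Fin d)),
      (ENNReal.ofReal ‖fderiv ℝ V x‖ + ENNReal.ofReal ‖fderiv ℝ (fderiv ℝ V) x‖ +
        lipHess V (Metric.ball x (M.lbar / √(n : ℝ)))) * ENNReal.ofReal (1 + ‖x‖) ≤
          ENNReal.ofReal (C * V x)) :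
    (∃ N : ℕ+, ∀ n ≥ N,
      -- the drift inequality, with all expectations finite
      (∀ (x : M.Ehat n) (t : ℝ), 0 ≤ t →
        Integrable (fun ω => V (M.toHat n (X n t ω))) (P n (M.ofHat n x)) ∧
        Integrable (fun p : Ω n × ℝ => V (M.toHat n (X n p.2 p.1)))
          ((P n (M.ofHat n x)).prod (volume.restrict (Set.Ioc 0 t))) ∧
        ∫ ω, V (M.toHat n (X n t ω)) ∂P n (M.ofHat n x) ≤
          V x + ∫ ω, (∫ s in (0 : ℝ)..t, (-(δ / 2) * V (M.toHat n (X n s ω)) + b))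
            ∂P n (M.ofHat n x)) ∧
      -- ergodicity
      (((∀ r : ℝ, (M.E n ∩ Metric.closedBall 0 r).Finite) ∨
          ∃ ν, IsStationaryDist (fun x => P n (M.ofHat n x)) (fun t ω => M.toHat n (X n t ω)) ν) →
        IsErgodic (fun x => P n (M.ofHat n x)) (fun t ω => M.toHat n (X n t ω)))) ∧
    -- the limiting bound on the steady-state distributions
    (∀ ν : ∀ n, Measure (M.Ehat n),
      (∀ᶠ n in atTop, IsSteadyStateDist (fun x => P n (M.ofHat n x))
        (fun t ω => M.toHat n (X n t ω)) (ν n)) →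
      limsup (fun n => ∫⁻ x, ENNReal.ofReal (V x) ∂ν n) atTop ≤ ENNReal.ofReal (2 * b / δ)) := by

  have hV0 : ∀ x, 0 ≤ V x := fun x => zero_le_one.trans (hV.subExp.one_le x)
  have hδ2 : 0 < δ / 2 := half_pos hV.δ_pos
  obtain ⟨N, hN⟩ := eventually_atTop.1 (ChainSeq.eventually_drift hM hV.subExp.contDiff hV0
    hV.b_pos hV.δ_pos hV.drift hC hVC)
  have hcount : ∀ n, Countable (M.E n) := fun n => (hM.countable n).to_subtype
  have hcount' : ∀ n, Countable (M.Ehat n) := fun n => ((hM.countable n).image _).to_subtype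
  -- Discarding the terminal mean of `V` and dividing by `δ / 2` turns the slope `b` into `2 * b /
  -- δ`. This bound serves both tightness and the steady-state estimate.
  have hbound : ∀ n ≥ N, ∀ x : M.Ehat n, ∀ T : ℝ, 0 ≤ T →
      ∫⁻ s in Set.Icc (0 : ℝ) T, ∑' y : M.Ehat n,
        transProb (M.q n) s (M.hatEquiv n x) (M.hatEquiv n y) * ENNReal.ofReal (V y) ≤
      ENNReal.ofReal (V x / (δ / 2) + 2 * b / δ * T) := by
    intro n hn x T hT
    have h1 := le_add_self.trans (tsum_transProb_mul_add_le (M.q n) (hM.rate_summable n) (hN n hn)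
      (M.ofHat n x) hT)
    rw [ChainSeq.toHat_ofHat, ← ENNReal.ofReal_mul hV.b_pos.le,
      ← ENNReal.ofReal_add (hV0 _) (mul_nonneg hV.b_pos.le hT)] at h1
    refine le_trans (le_of_eq ?_) ((le_ofReal_div_of_ofReal_mul_le hδ2 h1).trans_eq ?_)
    · refine lintegral_congr fun s => ?_
      rw [← (M.hatEquiv n).tsum_eq]
      refine tsum_congr fun y => ?_
      congr 3
      exact congrArg Subtype.val (ChainSeq.toHat_ofHat n y).symm
    · congr 1
      field_simp
  refine ⟨⟨N, fun n hn => ⟨fun x t ht => ?_, fun hcases => ?_⟩⟩, fun ν hν => ?_⟩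
  · have := (hX n).integral_le_of_drift (g := fun y => V (M.toHat n y)) (fun y => hV0 _)
      hV.b_pos.le hδ2 (hM.rate_summable n) (hN n hn) (M.ofHat n x) ht
    rwa [ChainSeq.toHat_ofHat] at this
  · have htr := ChainSeq.hasTransition n (hX n)
    have hp := ((hX n).isMarkovSemigroup (hM.irreducible n)).comap_equiv (M.hatEquiv n)
    rcases hcases with hE | ⟨ν, hν⟩
    · obtain ⟨x₀, hx₀⟩ := hM.nonempty n
      set x : M.Ehat n := M.toHat n ⟨x₀, hx₀⟩
      -- Only `T ≥ 1` matters here, so the contribution of the initial state can be absorbed into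
      -- the linear coefficient.
      obtain ⟨π, hπ⟩ := hp.exists_isInvariantProb (fun x y => measurable_transProb _ _ _) x
        (ChainSeq.finite_sublevel hV.normLike n hE)
        (B := (V x / (δ / 2) + 2 * b / δ).toNNReal) fun T hT => by
          refine (hbound n hn x T (zero_le_one.trans hT)).trans ?_
          have hb := hV.b_pos
          have hδ := hV.δ_pos
          have hVx := div_nonneg (hV0 x) hδ2.le
          rw [← ENNReal.ofReal, ← ENNReal.ofReal_mul (by positivity)]
          refine ENNReal.ofReal_le_ofReal ?_
          nlinarith
      exact htr.isErgodic hp hπ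
    · exact htr.isErgodic hp (htr.isInvariantProb_of_isStationaryDist hν)
  · refine limsup_le_of_le (h := ?_)
    filter_upwards [hν, eventually_ge_atTop N] with n hνn hn
    obtain ⟨x₀, hx₀⟩ := hM.nonempty n
    exact (ChainSeq.hasTransition n (hX n)).lintegral_le_of_isSteadyStateDist hνn
      (M.toHat n ⟨x₀, hx₀⟩) (hV.subExp.contDiff.continuous.comp continuous_subtype_val)
      (fun y => hV0 _) (div_nonneg (mul_nonneg zero_le_two hV.b_pos.le) hV.δ_pos.le)
      (hbound n hn _)
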